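/- All graphs are finite, simple and undirected. For a graph $G=(V,E)$, a vertex $a$ and $W\subseteq V$, write $N(a)$ for the set of neighbours of $a$, $N[a]=N(a)\cup\{a\}$, and $N(W)$ for the set of vertices of $V\setminus W$ that have a neighbour in $W$. **Graph classes.** $G$ is *distance hereditary* if for every connected induced subgraph $H$ of $G$ and all vertices $u,v$ of $H$ the distance between $u$ and $v$ is the same in $H$ as in $G$. $G$ is a *permutation graph* if its vertices can be numbered $v_1,\dots,v_n$ so that for some permutation $\pi$ of $\{1,\dots,n\}$ and all $i,j$: $v_iv_j\in E$ if and only if $(i-j)(\pi^{-1}(i)-\pi^{-1}(j))<0$. $G$ is *AT-free* if there is no set $A$ of three vertices such that for each $a\in A$ the two vertices of $A\setminus\{a\}$ are joined by a path in $G-N[a]$. **Split decompositions.** A *split* of $G$ is a partition $\{V_1,V_2\}$ of $V$ with $|V_1|,|V_2|>1$ such that, for $x\in V_1$ and $y\in V_2$, $xy\in E$ if and only if $x\in N(V_2)$ and $y\in N(V_1)$. A graph with no split is *prime*. Given a split, the corresponding *simple split decomposition* is $\{G_1,G_2\}$, where $G_1$ is $G[V_1]$ with a new vertex $v\notin V$,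 the *marker*, added whose neighbourhood is $N(V_2)$, and $G_2$ is $G[V_2]$ with the same vertex $v$ added with neighbourhood $N(V_1)$. A *split decomposition* of $G$ is a set of graphs obtained from $\{G\}$ by repeatedly (zero or more times) replacing one graph of the set by the two graphs of one of its simple split decompositions, each time with a new marker not used so far; if $D'$ is obtained from $D$ by one or more such replacements, $D'$ is a *strict refinement* of $D$. A *standard split decomposition* of $G$ is a split decomposition of $G$ that contains only prime graphs, cliques and stars and is not a strict refinement of any other split decomposition of $G$ containing only prime graphs, cliques and stars. (For connected $G$ it is unique up to the names of the markers.) Its *tree* has one node for each graph of the decomposition, two nodes being adjacent if the graphs share a marker. **Pruning.** A *pruned decomposition tree* of $G$ is produced by starting with the tree of a standard split decomposition of $G$ and repeatedly removing a leaf (a node with exactly one neighbour) whose marker is adjacent to all other vertices of the graph at that leaf, until no such leaf remains. When a leaf is removed, the other copy of its marker becomes an ordinary vertex. **Theorem.** Let $G$ be a connected distance hereditary graph. The following are equivalent: 1. $G$ is a permutation graph. 2. $G$ is AT-free. 3. The pruned decomposition tree of $G$ is a path (a single node counts as a path). Here (3) does not depend on the choices made in its construction: the equivalence holds both with "some pruned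 decomposition tree of $G$ is a path" and with "every pruned decomposition tree of $G$ is a path" in place of (3). -/

import Mathlib

namespace SplitDecomp

/-! ### Graph classes -/

section GraphClasses

variable {V : Type*}

/-- `G` is a permutation graph: for some numbering `e` of its `n` vertices and some permutation `π`
of the numbers, `v_i v_j` is an edge iff `(i - j) * (π⁻¹ i - π⁻¹ j) < 0`. -/
def IsPermutationGraph (G : SimpleGraph V) : Prop :=
  ∃ (n : ℕ) (e : V ≃ Fin n) (π : Equiv.Perm (Fin n)), ∀ u v : V,
    G.Adj u v ↔
      (((e u : ℕ) : ℤ) - ((e v : ℕ) : ℤ)) *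
        (((π.symm (e u) : ℕ) : ℤ) - ((π.symm (e v) : ℕ) : ℤ)) < 0

/-- `A` is asteroidal: for every `a ∈ A`, any two vertices of `A \ {a}` are joined by a path of
`G - N[a]`. -/
def IsAsteroidalSet (G : SimpleGraph V) (A : Finset V) : Prop :=
  ∀ a ∈ A, ∀ x ∈ A, ∀ y ∈ A, x ≠ a → y ≠ a →
    ∃ p : G.Walk x y, p.IsPath ∧ ∀ z ∈ p.support, z ≠ a ∧ ¬ G.Adj a z

/-- `G` has no asteroidal triple. -/
def IsATFree (G : SimpleGraph V) : Prop :=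
  ¬ ∃ A : Finset V, A.card = 3 ∧ IsAsteroidalSet G A

/-- Distances in connected induced subgraphs agree with distances in `G`. -/
def IsDistanceHereditary (G : SimpleGraph V) : Prop :=
  ∀ S : Set V, (G.induce S).Connected →
    ∀ u v : S, (G.induce S).dist u v = G.dist (u : V) (v : V)

/-- `T` is a path (a single vertex is a path). -/
def IsPathGraph (T : SimpleGraph V) : Prop :=
  ∃ n : ℕ, Nonempty (T ≃g SimpleGraph.pathGraph n)

end GraphClasses

/-! ### Graphs whose vertices are labels, and split decompositions -/

/-- A simple graph whose vertex set is a set of labels from `α`. -/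
abbrev LGraph (α : Type*) := (⊤ : SimpleGraph α).Subgraph

variable {α : Type*}

/-- The neighbourhood `N_K(W)` of a set `W` of vertices: vertices outside `W` with a neighbour
in `W`. -/
def nbhd (K : LGraph α) (W : Set α) : Set α :=
  {v | v ∈ K.verts \ W ∧ ∃ w ∈ W, K.Adj w v}

/-- `{V₁, V₂}` is a split of `K`. -/
structure IsSplit (K : LGraph α) (V₁ V₂ : Set α) : Prop where
  union_eq : V₁ ∪ V₂ = K.verts
  disjoint : Disjoint V₁ V₂
  nontrivial_left : V₁.Nontrivial
  nontrivial_right : V₂.Nontrivial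
  adj_iff : ∀ x ∈ V₁, ∀ y ∈ V₂, K.Adj x y ↔ x ∈ nbhd K V₂ ∧ y ∈ nbhd K V₁

/-- A graph with no split. -/
def IsPrime (K : LGraph α) : Prop := ¬ ∃ V₁ V₂ : Set α, IsSplit K V₁ V₂

def IsCliqueGraph (K : LGraph α) : Prop :=
  ∀ x ∈ K.verts, ∀ y ∈ K.verts, x ≠ y → K.Adj x y

/-- `K` is a star: for some centre `c`, the edges are exactly the pairs `c x` with `x ≠ c`. -/
def IsStar (K : LGraph α) : Prop :=
  ∃ c ∈ K.verts, ∀ x ∈ K.verts, ∀ y ∈ K.verts, K.Adj x y ↔ x ≠ y ∧ (x = c ∨ y = c)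

/-- The graph `K[W]` to which a new vertex `v` with neighbourhood `W ∩ N_K(U)` has been added. -/
def withMarker (K : LGraph α) (W U : Set α) (v : α) : LGraph α where
  verts := insert v W
  Adj x y := x ≠ y ∧ ((x ∈ W ∧ y ∈ W ∧ K.Adj x y) ∨
    (x = v ∧ y ∈ W ∧ y ∈ nbhd K U) ∨ (y = v ∧ x ∈ W ∧ x ∈ nbhd K U))
  adj_sub := by
    intro x y h
    simpa using h.1
  edge_vert := by
    rintro x y ⟨-, ⟨h, -, -⟩ | ⟨h, -, -⟩ | ⟨-, h, -⟩⟩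
    · exact Set.mem_insert_of_mem _ h
    · exact h ▸ Set.mem_insert _ _
    · exact Set.mem_insert_of_mem _ h
  symm := by
    refine ⟨?_⟩
    rintro x y ⟨hne, ⟨h₁, h₂, h₃⟩ | h | h⟩
    · exact ⟨hne.symm, Or.inl ⟨h₂, h₁, h₃.symm⟩⟩
    · exact ⟨hne.symm, Or.inr (Or.inr h)⟩
    · exact ⟨hne.symm, Or.inr (Or.inl h)⟩

/-- `{K₁, K₂}` is a simple split decomposition of `K` with marker vertex `v`. -/
def IsSimpleSplitDecomp (K : LGraph α) (v : α) (K₁ K₂ : LGraph α) : Prop :=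
  v ∉ K.verts ∧ ∃ V₁ V₂ : Set α, IsSplit K V₁ V₂ ∧
    K₁ = withMarker K V₁ V₂ v ∧ K₂ = withMarker K V₂ V₁ v

/-- `D'` is obtained from the set of graphs `D` by replacing one graph `K` of `D` with the two
graphs of one of its simple split decompositions; the marker is a label not used in `D`. -/
def SplitStep (D D' : Set (LGraph α)) : Prop :=
  ∃ K ∈ D, ∃ (v : α) (K₁ K₂ : LGraph α), (∀ L ∈ D, v ∉ L.verts) ∧
    IsSimpleSplitDecomp K v K₁ K₂ ∧ D' = (D \ {K}) ∪ {K₁, K₂}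

/-- `D` is a split decomposition of `K`. -/
def IsSplitDecomp (K : LGraph α) (D : Set (LGraph α)) : Prop :=
  Relation.ReflTransGen SplitStep {K} D

/-- `D'` is a strict refinement of `D`. -/
def IsStrictRefinement (D' D : Set (LGraph α)) : Prop :=
  Relation.TransGen SplitStep D D'

/-- `D` is a split decomposition of `K` into prime graphs, cliques and stars. -/
def IsPCSDecomp (K : LGraph α) (D : Set (LGraph α)) : Prop :=
  IsSplitDecomp K D ∧ ∀ L ∈ D, IsPrime L ∨ IsCliqueGraph L ∨ IsStar L

/-- `D` is a standard split decomposition of `K`: it contains only prime graphs, cliques and stars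
and is not a strict refinement of any other such split decomposition. -/
def IsStandardDecomp (K : LGraph α) (D : Set (LGraph α)) : Prop :=
  IsPCSDecomp K D ∧ ∀ D' : Set (LGraph α), IsPCSDecomp K D' → ¬ IsStrictRefinement D D'

/-! ### Decomposition trees and pruning -/

/-- The tree of a decomposition `D`: one node for each graph of `D`, with an edge between two
distinct nodes if they share a (marker) vertex. In a decomposition, and in whatever remains of it
after nodes have been removed, a vertex label lying in two distinct graphs is always a marker;
a marker one of whose copies has been removed is an ordinary vertex. -/
def decompTree (D : Set (LGraph α)) : SimpleGraph D where
  Adj x y := x ≠ y ∧ ((x : LGraph α).verts ∩ (y : LGraph α).verts).Nonempty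
  symm := by
    refine ⟨?_⟩
    rintro x y ⟨hne, h⟩
    exact ⟨hne.symm, by rwa [Set.inter_comm]⟩
  loopless := by
    refine ⟨?_⟩
    rintro x ⟨hne, -⟩
    exact hne rfl

/-- `v` is a vertex of `K` adjacent to all other vertices of `K`. -/
def IsUniversalIn (K : LGraph α) (v : α) : Prop :=
  v ∈ K.verts ∧ ∀ w ∈ K.verts, w ≠ v → K.Adj v w

/-- `D'` is obtained from `D` by removing a leaf `x` of the tree (a node with exactly one
neighbour `y`) whose marker vertex `l`, shared with `y`, is universal in the graph `x`. -/
def PruneStep (D D' : Set (LGraph α)) : Prop :=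
  ∃ x y : D, (∀ z : D, (decompTree D).Adj x z ↔ z = y) ∧
    (∃ l ∈ (y : LGraph α).verts, IsUniversalIn (x : LGraph α) l) ∧ D' = D \ {(x : LGraph α)}

/-- `D` is produced from a standard split decomposition of `K` by pruning for as long as possible. -/
def IsPrunedDecomp (K : LGraph α) (D : Set (LGraph α)) : Prop :=
  ∃ D₀ : Set (LGraph α), IsStandardDecomp K D₀ ∧
    Relation.ReflTransGen PruneStep D₀ D ∧ ¬ ∃ D' : Set (LGraph α), PruneStep D D'

/-- `G` as a labelled graph. The labels `Sum.inl u` are the vertices of `G`, and the labels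
`Sum.inr n` are an infinite supply of names for marker vertices. -/
def toLGraph {V : Type*} (G : SimpleGraph V) : LGraph (V ⊕ ℕ) where
  verts := Set.range Sum.inl
  Adj x y := ∃ u v : V, x = Sum.inl u ∧ y = Sum.inl v ∧ G.Adj u v
  adj_sub := by
    rintro x y ⟨u, v, rfl, rfl, h⟩
    simpa using h.ne
  edge_vert := by
    rintro x y ⟨u, v, rfl, rfl, h⟩
    exact ⟨u, rfl⟩
  symm := by
    refine ⟨?_⟩
    rintro x y ⟨u, v, rfl, rfl, h⟩
    exact ⟨v, u, rfl, rfl, h.symm⟩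

end SplitDecomp

/-!
Split decompositions are handled in a recursive form. `IsComp K K₁ K₂ v` says that `K` is glued from
`K₁` and `K₂` at the marker `v`, and `Dec K D` says that `D` arises from `K` by choosing a first
split and decomposing the two parts (`Dec.of_isSplitDecomp`, `Dec.isSplitDecomp`). Since gluing is
associative (`IsComp.assoc`), every edge of the decomposition tree may serve as the first split
(`Dec.split_at`); hence a leaf can be cut off, leaving a decomposition of an induced subgraph
(`Dec.remove_leaf`), and two adjacent nodes can be merged (`Dec.merge_at`).

The graphs of a decomposition of a connected distance hereditary graph are isomorphic to connected
induced subgraphs of it, and a prime connected distance hereditary graph is a clique or a star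
(`isCliqueGraph_or_isStar_of_isPrime`). So all nodes of a standard decomposition are cliques and
stars, and by minimality no marker is the centre of a star on one side and a leaf of a star on the
other (`IsStandardDecomp.starReduced`).

Permutation graphs are AT-free because a vertex that lies between two others in both orders
separates them by its closed neighbourhood (`IsPermutationGraph.isATFree`).

A leaf of the tree that cannot be pruned is a star whose marker is not the centre. It contains a
vertex all of whose neighbours lie in that star, while the rest of the graph stays connected when
the star is deleted, because the marker is not a star centre on the other side either. Three such
leaves therefore give an asteroidal triple (`Dec.hasAT_of_three_leaves`), and a decomposition tree
without three leaves is a path (`Dec.pathEnum`). Asteroidal triples pass from the pruned graph,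
an induced subgraph, to the original one.

Conversely, a graph whose tree is a path of cliques and stars has a permutation model, built along
the path by keeping the next marker last in one of the two orders (`Dec.isPermLast`). Undoing a
pruning step substitutes a clique or an independent set for a vertex, which preserves permutation
graphs (`IsComp.isPerm_of_universal`).

Standard decompositions exist: a decomposition with the greatest number of graphs consists of prime
graphs, and among those into prime graphs, cliques and stars one with the least number of graphs is
standard (`exists_isStandardDecomp`).
-/

namespace SplitDecomp

variable {α : Type*}

/-! ### Composition of two graphs at a marker -/

/-- All labels occurring in the graphs of `D`. -/
def labels (D : Set (LGraph α)) : Set α := {a | ∃ L ∈ D, a ∈ L.verts}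

/-- `K` is the composition of `K₁` and `K₂` at their only common vertex `v`, which is isolated in
neither: delete `v` and join its two neighbourhoods completely. This inverts a simple split
decomposition of a connected graph. -/
structure IsComp (K K₁ K₂ : LGraph α) (v : α) : Prop where
  left_mem : v ∈ K₁.verts
  right_mem : v ∈ K₂.verts
  inter : ∀ z, z ∈ K₁.verts → z ∈ K₂.verts → z = v
  nontrivial_left : (K₁.verts \ {v}).Nontrivial
  nontrivial_right : (K₂.verts \ {v}).Nontrivial
  nbr_left : ∃ z, K₁.Adj v z
  nbr_right : ∃ z, K₂.Adj v z
  mem_iff : ∀ z, z ∈ K.verts ↔ z ≠ v ∧ (z ∈ K₁.verts ∨ z ∈ K₂.verts)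
  adj_iff : ∀ x y, K.Adj x y ↔ x ≠ v ∧ y ≠ v ∧
    (K₁.Adj x y ∨ K₂.Adj x y ∨ (K₁.Adj x v ∧ K₂.Adj v y) ∨ (K₂.Adj x v ∧ K₁.Adj v y))

/-- The graph obtained from `K₁` and `K₂` by deleting `v` and joining its two neighbourhoods. The
clause `x ≠ y` is automatic when `v` is the only common vertex. -/
def merge (K₁ K₂ : LGraph α) (v : α) : LGraph α where
  verts := {z | z ≠ v ∧ (z ∈ K₁.verts ∨ z ∈ K₂.verts)}
  Adj x y := x ≠ y ∧ x ≠ v ∧ y ≠ v ∧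
    (K₁.Adj x y ∨ K₂.Adj x y ∨ (K₁.Adj x v ∧ K₂.Adj v y) ∨ (K₂.Adj x v ∧ K₁.Adj v y))
  adj_sub := by
    intro x y h
    simpa using h.1
  edge_vert := by
    rintro x y ⟨-, hx, -, h | h | ⟨h, -⟩ | ⟨h, -⟩⟩
    · exact ⟨hx, Or.inl h.fst_mem⟩
    · exact ⟨hx, Or.inr h.fst_mem⟩
    · exact ⟨hx, Or.inl h.fst_mem⟩
    · exact ⟨hx, Or.inr h.fst_mem⟩
  symm := by
    refine ⟨?_⟩
    rintro x y ⟨hne, hx, hy, h⟩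
    refine ⟨hne.symm, hy, hx, ?_⟩
    rcases h with h | h | ⟨h, h'⟩ | ⟨h, h'⟩
    · exact Or.inl h.symm
    · exact Or.inr (Or.inl h.symm)
    · exact Or.inr (Or.inr (Or.inr ⟨h'.symm, h.symm⟩))
    · exact Or.inr (Or.inr (Or.inl ⟨h'.symm, h.symm⟩))

lemma isComp_merge {K₁ K₂ : LGraph α} {v : α} (h₁ : v ∈ K₁.verts) (h₂ : v ∈ K₂.verts)
    (hi : ∀ z, z ∈ K₁.verts → z ∈ K₂.verts → z = v)
    (n₁ : (K₁.verts \ {v}).Nontrivial) (n₂ : (K₂.verts \ {v}).Nontrivial)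
    (a₁ : ∃ z, K₁.Adj v z) (a₂ : ∃ z, K₂.Adj v z) : IsComp (merge K₁ K₂ v) K₁ K₂ v where
  left_mem := h₁
  right_mem := h₂
  inter := hi
  nontrivial_left := n₁
  nontrivial_right := n₂
  nbr_left := a₁
  nbr_right := a₂
  mem_iff := fun z => Iff.rfl
  adj_iff := by
    intro x y
    refine ⟨fun h => h.2, fun h => ⟨?_, h⟩⟩
    rintro rfl
    obtain ⟨hx, -, h | h | ⟨h, h'⟩ | ⟨h, h'⟩⟩ := h
    · exact h.ne rfl
    · exact h.ne rfl
    · exact hx (hi _ h.fst_mem h'.snd_mem)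
    · exact hx (hi _ h'.snd_mem h.fst_mem)

namespace IsComp

variable {K K₁ K₂ : LGraph α} {v : α}

lemma symm (h : IsComp K K₁ K₂ v) : IsComp K K₂ K₁ v where
  left_mem := h.right_mem
  right_mem := h.left_mem
  inter := fun z h₁ h₂ => h.inter z h₂ h₁
  nontrivial_left := h.nontrivial_right
  nontrivial_right := h.nontrivial_left
  nbr_left := h.nbr_right
  nbr_right := h.nbr_left
  mem_iff := fun z => by rw [h.mem_iff z, or_comm]
  adj_iff := fun x y => by rw [h.adj_iff x y]; tauto

lemma notMem (h : IsComp K K₁ K₂ v) : v ∉ K.verts := fun hv => ((h.mem_iff v).1 hv).1 rfl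

lemma mem_left (h : IsComp K K₁ K₂ v) {z : α} (hz : z ∈ K₁.verts) (hv : z ≠ v) : z ∈ K.verts :=
  (h.mem_iff z).2 ⟨hv, Or.inl hz⟩

lemma mem_right (h : IsComp K K₁ K₂ v) {z : α} (hz : z ∈ K₂.verts) (hv : z ≠ v) : z ∈ K.verts :=
  (h.mem_iff z).2 ⟨hv, Or.inr hz⟩

lemma adj_left (h : IsComp K K₁ K₂ v) {x y : α} (hx : x ∈ K₁.verts) (hy : y ∈ K₁.verts)
    (hxv : x ≠ v) (hyv : y ≠ v) : K.Adj x y ↔ K₁.Adj x y := by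
  rw [h.adj_iff]
  refine ⟨?_, fun h' => ⟨hxv, hyv, Or.inl h'⟩⟩
  rintro ⟨-, -, h' | h' | ⟨-, h'⟩ | ⟨h', -⟩⟩
  · exact h'
  · exact absurd (h.inter _ hx h'.fst_mem) hxv
  · exact absurd (h.inter _ hy h'.snd_mem) hyv
  · exact absurd (h.inter _ hx h'.fst_mem) hxv

lemma adj_cross (h : IsComp K K₁ K₂ v) {x y : α} (hx : x ∈ K₁.verts) (hy : y ∈ K₂.verts)
    (hxv : x ≠ v) (hyv : y ≠ v) : K.Adj x y ↔ K₁.Adj x v ∧ K₂.Adj v y := by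
  rw [h.adj_iff]
  refine ⟨?_, fun h' => ⟨hxv, hyv, Or.inr (Or.inr (Or.inl h'))⟩⟩
  rintro ⟨-, -, h' | h' | h' | ⟨h', -⟩⟩
  · exact absurd (h.inter _ h'.snd_mem hy) hyv
  · exact absurd (h.inter _ hx h'.fst_mem) hxv
  · exact h'
  · exact absurd (h.inter _ hx h'.fst_mem) hxv

/-- Composition is associative: if `K₁` is itself a composition of `A` and `B` and the marker `v`
lies in `A`, then `K₂` can be composed with `A` first. -/
lemma assoc (h : IsComp K K₁ K₂ v) {A B : LGraph α} {m : α} (h' : IsComp K₁ A B m)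
    (hv : v ∈ A.verts) (hm : m ∉ K₂.verts) :
    IsComp (merge A K₂ v) A K₂ v ∧ IsComp K (merge A K₂ v) B m := by
  have hmv : m ≠ v := fun e => hm (e ▸ h.right_mem)
  have hvB : v ∉ B.verts := fun hb => hmv (h'.inter _ hv hb).symm
  have hAK : ∀ z, z ∈ A.verts → z ∈ K₂.verts → z = v := fun z hz hz' =>
    h.inter z (h'.mem_left hz (fun e => hm (e ▸ hz'))) hz'
  have hBK : ∀ z, z ∈ B.verts → z ∉ K₂.verts := fun z hz hz' =>
    hvB ((h.inter z (h'.mem_right hz (fun e => hm (e ▸ hz'))) hz') ▸ hz)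
  obtain ⟨b, hb⟩ := h'.nbr_right
  obtain ⟨k, hk⟩ := h.nbr_right
  have hkv : k ≠ v := hk.ne.symm
  have hA : IsComp (merge A K₂ v) A K₂ v := by
    refine isComp_merge hv h.right_mem hAK ⟨m, ⟨h'.left_mem, hmv⟩, ?_⟩ h.nontrivial_right ?_
      h.nbr_right
    · obtain ⟨z, hz, hzm⟩ := h'.nontrivial_left.exists_ne v
      exact ⟨z, ⟨hz.1, hzm⟩, fun e => hz.2 e.symm⟩
    · obtain ⟨z, hz⟩ := h.nbr_left
      rw [h'.adj_iff] at hz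
      obtain ⟨-, -, hz | hz | ⟨hz, -⟩ | ⟨hz, -⟩⟩ := hz
      · exact ⟨z, hz⟩
      · exact absurd hz.fst_mem hvB
      · exact ⟨m, hz⟩
      · exact absurd hz.fst_mem hvB
  refine ⟨hA, ?_⟩
  refine ⟨hA.mem_left h'.left_mem hmv, h'.right_mem, ?_, ?_, h'.nontrivial_right, ?_, h'.nbr_right,
    ?_, ?_⟩
  · intro z hz hzB
    rcases hz with ⟨-, hz | hz⟩
    · exact h'.inter z hz hzB
    · exact absurd hz (hBK z hzB)
  · refine h.nontrivial_right.mono ?_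
    rintro z ⟨hz, hzv⟩
    exact ⟨hA.mem_right hz hzv, fun e => hm (e ▸ hz)⟩
  · obtain ⟨z, hz⟩ := h'.nbr_left
    by_cases hzv : z = v
    · subst hzv
      exact ⟨k, (hA.adj_iff _ _).2 ⟨hmv, hkv, Or.inr (Or.inr (Or.inl ⟨hz, hk⟩))⟩⟩
    · exact ⟨z, (hA.adj_iff _ _).2 ⟨hmv, hzv, Or.inl hz⟩⟩
  · intro z
    rw [h.mem_iff, hA.mem_iff, h'.mem_iff]
    have h1 : z ∈ K₂.verts → z ≠ m := fun hz e => hm (e ▸ hz)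
    have h2 : z ∈ B.verts → z ≠ v := fun hz e => hvB (e ▸ hz)
    tauto
  · intro x y
    have e1 : ∀ {a}, ¬ K₂.Adj a m := fun hh => hm hh.snd_mem
    have e2 : ∀ {a}, ¬ K₂.Adj m a := fun hh => hm hh.fst_mem
    have e3 : ∀ {a}, ¬ B.Adj a v := fun hh => hvB hh.snd_mem
    have e4 : ∀ {a}, ¬ B.Adj v a := fun hh => hvB hh.fst_mem
    have e5 : ∀ {a}, K₂.Adj a x → x ≠ m := fun hh e => hm (e ▸ hh.snd_mem)
    have e6 : ∀ {a}, K₂.Adj x a → x ≠ m := fun hh e => hm (e ▸ hh.fst_mem)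
    have e7 : ∀ {a}, K₂.Adj a y → y ≠ m := fun hh e => hm (e ▸ hh.snd_mem)
    have e8 : ∀ {a}, B.Adj a x → x ≠ v := fun hh e => hvB (e ▸ hh.snd_mem)
    have e9 : ∀ {a}, B.Adj x a → x ≠ v := fun hh e => hvB (e ▸ hh.fst_mem)
    have e10 : ∀ {a}, B.Adj a y → y ≠ v := fun hh e => hvB (e ▸ hh.snd_mem)
    have e11 : ∀ {a}, B.Adj y a → y ≠ v := fun hh e => hvB (e ▸ hh.fst_mem)
    simp only [h.adj_iff, hA.adj_iff, h'.adj_iff]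
    have i1 := @e1 x
    have i2 := @e2 y
    have i3 := @e3 x
    have i4 := @e4 y
    have j5 := @e6 v
    have j6 := @e7 v
    have j7 := @e9 m
    have j8 := @e10 m
    have j9 := @e6 y
    have j10 := @e7 x
    have j11 := @e9 y
    have j12 := @e10 x
    have hvm := hmv.symm
    grind

lemma verts_nontrivial_left (h : IsComp K K₁ K₂ v) : K₁.verts.Nontrivial :=
  h.nontrivial_left.mono Set.sdiff_subset

end IsComp

/-! ### Recursive description of split decompositions -/

/-- `Dec K D`: `D` is a split decomposition of `K`, described recursively by its first split. The
decompositions of the two parts share no label besides the marker of that split. -/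
inductive Dec : LGraph α → Set (LGraph α) → Prop
  | single (K : LGraph α) : Dec K {K}
  | node {K K₁ K₂ : LGraph α} {v : α} {D₁ D₂ : Set (LGraph α)} (h : IsComp K K₁ K₂ v)
      (h₁ : Dec K₁ D₁) (h₂ : Dec K₂ D₂) (hi : ∀ z ∈ labels D₁, z ∈ labels D₂ → z = v) :
      Dec K (D₁ ∪ D₂)

lemma mem_labels {D : Set (LGraph α)} {L : LGraph α} {z : α} (hL : L ∈ D) (hz : z ∈ L.verts) :
    z ∈ labels D := ⟨L, hL, hz⟩

lemma labels_union (D E : Set (LGraph α)) : labels (D ∪ E) = labels D ∪ labels E := by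
  ext z
  simp only [labels, Set.mem_union, Set.mem_ofPred_eq]
  constructor
  · rintro ⟨L, hL | hL, hz⟩
    · exact Or.inl ⟨L, hL, hz⟩
    · exact Or.inr ⟨L, hL, hz⟩
  · rintro (⟨L, hL, hz⟩ | ⟨L, hL, hz⟩)
    · exact ⟨L, Or.inl hL, hz⟩
    · exact ⟨L, Or.inr hL, hz⟩

lemma labels_mono {D E : Set (LGraph α)} (h : D ⊆ E) : labels D ⊆ labels E := by
  rintro z ⟨L, hL, hz⟩
  exact ⟨L, h hL, hz⟩

lemma labels_singleton (L : LGraph α) : labels {L} = L.verts := by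
  ext z
  simp [labels]

namespace Dec

variable {K K₁ K₂ : LGraph α} {D D₁ D₂ : Set (LGraph α)} {v m : α}

lemma nonempty (h : Dec K D) : D.Nonempty := by
  induction h with
  | single K => exact ⟨K, rfl⟩
  | node _ _ _ _ ih _ => exact ih.mono Set.subset_union_left

lemma verts_subset (h : Dec K D) : K.verts ⊆ labels D := by
  induction h with
  | single K => rw [labels_singleton]
  | node h _ _ _ ih₁ ih₂ =>
    intro z hz
    rw [labels_union]
    rcases ((h.mem_iff z).1 hz).2 with hz | hz
    · exact Or.inl (ih₁ hz)
    · exact Or.inr (ih₂ hz)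

lemma nontrivial_of_mem (h : Dec K D) (hK : K.verts.Nontrivial) :
    ∀ L ∈ D, L.verts.Nontrivial := by
  induction h with
  | single K => rintro L rfl; exact hK
  | node h _ _ _ ih₁ ih₂ =>
    rintro L (hL | hL)
    · exact ih₁ h.verts_nontrivial_left L hL
    · exact ih₂ h.symm.verts_nontrivial_left L hL

lemma exists_mem_verts (h : Dec K D) (hm : m ∈ K.verts) : ∃ L ∈ D, m ∈ L.verts := h.verts_subset hm

/-- The two sides of a node of the recursion have no graph in common. -/
lemma disjoint_of_node (h : IsComp K K₁ K₂ v) (h₁ : Dec K₁ D₁)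
    (hi : ∀ z ∈ labels D₁, z ∈ labels D₂ → z = v) {L : LGraph α} (hL₁ : L ∈ D₁) : L ∉ D₂ := by
  intro hL₂
  obtain ⟨z, hz, hzv⟩ := (h₁.nontrivial_of_mem h.verts_nontrivial_left L hL₁).exists_ne v
  exact hzv (hi z (mem_labels hL₁ hz) (mem_labels hL₂ hz))

/-- A label shared by two graphs of a decomposition is not a vertex of the decomposed graph. -/
lemma notMem_of_shared (h : Dec K D) {x y : LGraph α} (hx : x ∈ D) (hy : y ∈ D) (hne : x ≠ y)
    (hmx : m ∈ x.verts) (hmy : m ∈ y.verts) : m ∉ K.verts := by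
  induction h with
  | single K => exact absurd (hx.trans hy.symm) hne
  | @node K K₁ K₂ v D₁ D₂ h h₁ h₂ hi ih₁ ih₂ =>
    intro hm
    obtain ⟨hmv, hm⟩ := (h.mem_iff m).1 hm
    rcases hx with hx | hx <;> rcases hy with hy | hy
    · rcases hm with hm | hm
      · exact ih₁ hx hy hm
      · exact hmv (hi m (mem_labels hx hmx) (h₂.verts_subset hm))
    · exact hmv (hi m (mem_labels hx hmx) (mem_labels hy hmy))
    · exact hmv (hi m (mem_labels hy hmy) (mem_labels hx hmx))
    · rcases hm with hm | hm
      · exact hmv (hi m (h₁.verts_subset hm) (mem_labels hx hmx))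
      · exact ih₂ hx hy hm

lemma eq_of_mem_verts (h : Dec K D) {x y : LGraph α} (hx : x ∈ D) (hy : y ∈ D)
    (hmx : m ∈ x.verts) (hmy : m ∈ y.verts) (hm : m ∈ K.verts) : x = y := by
  by_contra hne
  exact h.notMem_of_shared hx hy hne hmx hmy hm

lemma eq_of_singleton (h : Dec K D) {x : LGraph α} (hD : D = {x}) : K = x := by
  cases h with
  | single => exact Set.singleton_injective hD
  | @node _ K₁ K₂ v D₁ D₂ h h₁ h₂ hi =>
    exfalso
    obtain ⟨a, ha⟩ := h₁.nonempty
    obtain ⟨b, hb⟩ := h₂.nonempty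
    have e₁ : a = x := by rw [← Set.mem_singleton_iff, ← hD]; exact Or.inl ha
    have e₂ : b = x := by rw [← Set.mem_singleton_iff, ← hD]; exact Or.inr hb
    rw [e₁, ← e₂] at ha
    exact disjoint_of_node h h₁ hi ha hb

/-- The decomposition tree has no isolated node unless it is a single node. -/
lemma exists_neighbor (h : Dec K D) {x : LGraph α} (hx : x ∈ D) (hD : D ≠ {x}) :
    ∃ z ∈ D, z ≠ x ∧ (x.verts ∩ z.verts).Nonempty := by
  have key : ∀ {K K₁ K₂ : LGraph α} {v} {D₁ D₂ : Set (LGraph α)}, IsComp K K₁ K₂ v → Dec K₁ D₁ →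
      Dec K₂ D₂ → (∀ z ∈ labels D₁, z ∈ labels D₂ → z = v) → x ∈ D₁ →
      (D₁ ≠ {x} → ∃ z ∈ D₁, z ≠ x ∧ (x.verts ∩ z.verts).Nonempty) →
      ∃ z ∈ D₁ ∪ D₂, z ≠ x ∧ (x.verts ∩ z.verts).Nonempty := by
    intro K K₁ K₂ v D₁ D₂ h h₁ h₂ hi hx ih
    by_cases hD₁ : D₁ = {x}
    · obtain ⟨z, hz, hvz⟩ := h₂.exists_mem_verts h.right_mem
      have := h₁.eq_of_singleton hD₁
      subst this
      refine ⟨z, Or.inr hz, ?_, v, h.left_mem, hvz⟩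
      rintro rfl
      exact disjoint_of_node h h₁ hi hx hz
    · obtain ⟨z, hz, hzx⟩ := ih hD₁
      exact ⟨z, Or.inl hz, hzx⟩
  induction h with
  | single K =>
    rw [Set.mem_singleton_iff] at hx
    exact absurd (by rw [hx]) hD
  | @node K K₁ K₂ v D₁ D₂ h h₁ h₂ hi ih₁ ih₂ =>
    rcases hx with hx | hx
    · exact key h h₁ h₂ hi hx (ih₁ hx)
    · rw [Set.union_comm]
      exact key h.symm h₂ h₁ (fun z hz hz' => hi z hz' hz) hx (ih₂ hx)

/-- Every edge of the decomposition tree corresponds to a split of the decomposed graph, which can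
be taken as the first one. -/
lemma split_at (h : Dec K D) {x y : LGraph α} (hx : x ∈ D) (hy : y ∈ D) (hne : x ≠ y)
    (hmx : m ∈ x.verts) (hmy : m ∈ y.verts) :
    ∃ (K₁ K₂ : LGraph α) (D₁ D₂ : Set (LGraph α)), IsComp K K₁ K₂ m ∧ Dec K₁ D₁ ∧ Dec K₂ D₂ ∧
      (∀ z ∈ labels D₁, z ∈ labels D₂ → z = m) ∧ D = D₁ ∪ D₂ ∧ x ∈ D₁ ∧ y ∈ D₂ := by
  have flip : ∀ {K : LGraph α} {D : Set (LGraph α)} {x y : LGraph α},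
      (∃ (K₁ K₂ : LGraph α) (D₁ D₂ : Set (LGraph α)), IsComp K K₁ K₂ m ∧ Dec K₁ D₁ ∧ Dec K₂ D₂ ∧
      (∀ z ∈ labels D₁, z ∈ labels D₂ → z = m) ∧ D = D₁ ∪ D₂ ∧ x ∈ D₁ ∧ y ∈ D₂) →
      (∃ (K₁ K₂ : LGraph α) (D₁ D₂ : Set (LGraph α)), IsComp K K₁ K₂ m ∧ Dec K₁ D₁ ∧ Dec K₂ D₂ ∧
      (∀ z ∈ labels D₁, z ∈ labels D₂ → z = m) ∧ D = D₁ ∪ D₂ ∧ y ∈ D₁ ∧ x ∈ D₂) := by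
    rintro K D x y ⟨K₁, K₂, D₁, D₂, h, h₁, h₂, hi, rfl, hx, hy⟩
    exact ⟨K₂, K₁, D₂, D₁, h.symm, h₂, h₁, fun z hz hz' => hi z hz' hz, Set.union_comm _ _, hy, hx⟩
  have key : ∀ {K K₁ K₂ : LGraph α} {v : α} {D₁ D₂ : Set (LGraph α)}, IsComp K K₁ K₂ v → Dec K₁ D₁ →
      Dec K₂ D₂ → (∀ z ∈ labels D₁, z ∈ labels D₂ → z = v) → m ∈ labels D₁ →
      (∀ {x y : LGraph α}, x ∈ D₁ → y ∈ D₁ → x ≠ y → m ∈ x.verts → m ∈ y.verts →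
      ∃ (A B : LGraph α) (E F : Set (LGraph α)), IsComp K₁ A B m ∧ Dec A E ∧ Dec B F ∧
      (∀ z ∈ labels E, z ∈ labels F → z = m) ∧ D₁ = E ∪ F ∧ x ∈ E ∧ y ∈ F) →
      ∀ {x y : LGraph α}, x ∈ D₁ → y ∈ D₁ → x ≠ y → m ∈ x.verts → m ∈ y.verts →
      ∃ (A B : LGraph α) (E F : Set (LGraph α)), IsComp K A B m ∧ Dec A E ∧ Dec B F ∧
      (∀ z ∈ labels E, z ∈ labels F → z = m) ∧ D₁ ∪ D₂ = E ∪ F ∧ x ∈ E ∧ y ∈ F := by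
    intro K K₁ K₂ v D₁ D₂ h h₁ h₂ hi hm ih x y hx hy hne hmx hmy
    -- the case in which the marker `v` lies on the side of `x`
    have left : ∀ {x y : LGraph α}, (∃ (A B : LGraph α) (E F : Set (LGraph α)), v ∈ A.verts ∧
        IsComp K₁ A B m ∧ Dec A E ∧ Dec B F ∧
        (∀ z ∈ labels E, z ∈ labels F → z = m) ∧ D₁ = E ∪ F ∧ x ∈ E ∧ y ∈ F) →
        ∃ (A B : LGraph α) (E F : Set (LGraph α)), IsComp K A B m ∧ Dec A E ∧ Dec B F ∧
        (∀ z ∈ labels E, z ∈ labels F → z = m) ∧ D₁ ∪ D₂ = E ∪ F ∧ x ∈ E ∧ y ∈ F := by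
      rintro x y ⟨A, B, E, F, hv, hc, hE, hF, hEF, rfl, hx, hy⟩
      have hvm : v ≠ m := fun e => hc.notMem (e ▸ h.left_mem)
      have hmK : m ∉ K₂.verts := fun hm' => hvm (hi m hm (h₂.verts_subset hm')).symm
      obtain ⟨c₁, c₂⟩ := h.assoc hc hv hmK
      refine ⟨merge A K₂ v, B, E ∪ D₂, F, c₂, node c₁ hE h₂ ?_, hF, ?_, ?_, Or.inl hx, hy⟩
      · intro z hz hz'
        exact hi z (labels_mono Set.subset_union_left hz) hz'
      · intro z hz hz'
        rw [labels_union] at hz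
        rcases hz with hz | hz
        · exact hEF z hz hz'
        · have hzv := hi z (labels_mono Set.subset_union_right hz') hz
          subst hzv
          exact hEF z (hE.verts_subset hv) hz'
      · rw [Set.union_assoc, Set.union_assoc, Set.union_comm F D₂]
    obtain ⟨A, B, E, F, hc, hE, hF, hEF, e, hx, hy⟩ := ih hx hy hne hmx hmy
    obtain ⟨hvm, hv | hv⟩ := (hc.mem_iff v).1 h.left_mem
    · exact left ⟨A, B, E, F, hv, hc, hE, hF, hEF, e, hx, hy⟩
    · refine flip (left ⟨B, A, F, E, hv, hc.symm, hF, hE, fun z hz hz' => hEF z hz' hz, ?_, hy, hx⟩)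
      rw [e, Set.union_comm]
  induction h generalizing x y with
  | single K => exact absurd (hx.trans hy.symm) hne
  | @node K K₁ K₂ v D₁ D₂ h h₁ h₂ hi ih₁ ih₂ =>
    have hi' : ∀ z ∈ labels D₂, z ∈ labels D₁ → z = v := fun z hz hz' => hi z hz' hz
    rcases hx with hx | hx <;> rcases hy with hy | hy
    · exact key h h₁ h₂ hi (mem_labels hx hmx) ih₁ hx hy hne hmx hmy
    · have e := hi m (mem_labels hx hmx) (mem_labels hy hmy)
      subst e
      exact ⟨K₁, K₂, D₁, D₂, h, h₁, h₂, hi, rfl, hx, hy⟩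
    · have e := hi m (mem_labels hy hmy) (mem_labels hx hmx)
      subst e
      exact flip ⟨K₁, K₂, D₁, D₂, h, h₁, h₂, hi, rfl, hy, hx⟩
    · rw [Set.union_comm]
      exact key h.symm h₂ h₁ hi' (mem_labels hx hmx) ih₂ hx hy hne hmx hmy

/-- Grafting: if `K₂` is attached at a vertex `m` of a graph `x` of a decomposition of `K₁`, then
`x` may be replaced by a decomposition of the composition of `x` and `K₂`. -/
lemma graft (h₁ : Dec K₁ D₁) (h : IsComp K K₁ K₂ m) {x : LGraph α} (hx : x ∈ D₁)
    (hmx : m ∈ x.verts) (hK₂ : ∀ z ∈ labels D₁, z ∈ K₂.verts → z = m) :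
    ∃ X : LGraph α, IsComp X x K₂ m ∧ ∀ E : Set (LGraph α), Dec X E →
      (∀ z ∈ labels E, z ∈ labels D₁ → z ∈ x.verts ∨ z ∈ K₂.verts) →
      Dec K ((D₁ \ {x}) ∪ E) := by
  have key : ∀ {L K K₁ A B : LGraph α} {v : α} {D₁ D₂ : Set (LGraph α)}, IsComp K K₁ K₂ m →
      IsComp K₁ A B v → Dec A D₁ → Dec B D₂ → (∀ z ∈ labels D₁, z ∈ labels D₂ → z = v) →
      (∀ z ∈ labels (D₁ ∪ D₂), z ∈ K₂.verts → z = m) → L ∈ D₁ → m ∈ L.verts →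
      (∀ {K : LGraph α}, IsComp K A K₂ m → 
      ∃ X : LGraph α, IsComp X L K₂ m ∧ ∀ E : Set (LGraph α), Dec X E →
      (∀ z ∈ labels E, z ∈ labels D₁ → z ∈ L.verts ∨ z ∈ K₂.verts) → Dec K ((D₁ \ {L}) ∪ E)) →
      ∃ X : LGraph α, IsComp X L K₂ m ∧ ∀ E : Set (LGraph α), Dec X E →
      (∀ z ∈ labels E, z ∈ labels (D₁ ∪ D₂) → z ∈ L.verts ∨ z ∈ K₂.verts) →
      Dec K (((D₁ ∪ D₂) \ {L}) ∪ E) := by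
    intro L K K₁ A B v D₁ D₂ h hc hA hB hi hK₂ hL hmL ih
    have hmv : m ≠ v := fun e => hc.notMem (e ▸ h.left_mem)
    have hmB : m ∉ B.verts := fun hm => hmv (hi m (mem_labels hL hmL) (hB.verts_subset hm))
    have hmA : m ∈ A.verts := ((hc.mem_iff m).1 h.left_mem).2.resolve_right hmB
    have hvK : v ∉ K₂.verts := fun hv => hmv
      (hK₂ v (labels_mono Set.subset_union_left (hA.verts_subset hc.left_mem)) hv).symm
    obtain ⟨c₁, c₂⟩ := h.assoc hc hmA hvK
    obtain ⟨X, hX, hE⟩ := ih c₁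
    refine ⟨X, hX, fun E hXE hEl => ?_⟩
    have hd := hE E hXE fun z hz hz' => hEl z hz (labels_mono Set.subset_union_left hz')
    have e : ((D₁ ∪ D₂) \ {L}) ∪ E = ((D₁ \ {L}) ∪ E) ∪ D₂ := by
      have : L ∉ D₂ := disjoint_of_node hc hA hi hL
      rw [Set.union_sdiff_distrib, Set.sdiff_singleton_eq_self this, Set.union_assoc,
        Set.union_comm D₂, ← Set.union_assoc]
    rw [e]
    refine node c₂ hd hB fun z hz hz' => ?_
    rw [labels_union] at hz
    rcases hz with hz | hz
    · exact hi z (labels_mono Set.sdiff_subset hz) hz'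
    · rcases hEl z hz (labels_mono Set.subset_union_right hz') with hzL | hzK
      · exact hi z (mem_labels hL hzL) hz'
      · have e := hK₂ z (labels_mono Set.subset_union_right hz') hzK
        subst e
        exact hi z (mem_labels hL hmL) hz'
  induction h₁ generalizing K with
  | single K₁ =>
    rw [Set.mem_singleton_iff] at hx
    subst hx
    exact ⟨K, h, fun E hE _ => by simpa using hE⟩
  | @node K₁ A B v D₁ D₂ hc hA hB hi ihA ihB =>
    rcases hx with hx | hx
    · exact key h hc hA hB hi hK₂ hx hmx fun hK => ihA hK hx
        fun z hz => hK₂ z (labels_mono Set.subset_union_left hz)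
    · rw [Set.union_comm] at hK₂ ⊢
      exact key h hc.symm hB hA (fun z hz hz' => hi z hz' hz) hK₂ hx hmx fun hK => ihB hK hx
        fun z hz => hK₂ z (labels_mono Set.subset_union_left hz)

/-- Replacing a graph of a decomposition by the two parts of one of its splits. -/
lemma refine_at (h : Dec K D) {L L₁ L₂ : LGraph α} (hL : L ∈ D) (hc : IsComp L L₁ L₂ v)
    (hv : v ∉ labels D) : Dec K ((D \ {L}) ∪ {L₁, L₂}) := by
  have key : ∀ {K K₁ K₂ : LGraph α} {m : α} {D₁ D₂ : Set (LGraph α)}, IsComp K K₁ K₂ m →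
      Dec K₁ D₁ → Dec K₂ D₂ → (∀ z ∈ labels D₁, z ∈ labels D₂ → z = m) → L ∈ D₁ →
      v ∉ labels (D₁ ∪ D₂) → (v ∉ labels D₁ → Dec K₁ ((D₁ \ {L}) ∪ {L₁, L₂})) →
      Dec K (((D₁ ∪ D₂) \ {L}) ∪ {L₁, L₂}) := by
    intro K K₁ K₂ m D₁ D₂ h h₁ h₂ hi hL hv ih
    have e : ((D₁ ∪ D₂) \ {L}) ∪ {L₁, L₂} = ((D₁ \ {L}) ∪ {L₁, L₂}) ∪ D₂ := by
      have : L ∉ D₂ := disjoint_of_node h h₁ hi hL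
      rw [Set.union_sdiff_distrib, Set.sdiff_singleton_eq_self this, Set.union_assoc,
        Set.union_comm D₂, ← Set.union_assoc]
    rw [e]
    refine node h (ih fun hv' => hv (labels_mono Set.subset_union_left hv')) h₂ fun z hz hz' => ?_
    rw [labels_union] at hz
    rcases hz with hz | ⟨X, hX, hz⟩
    · exact hi z (labels_mono Set.sdiff_subset hz) hz'
    · refine hi z (mem_labels hL ((hc.mem_iff z).2 ⟨?_, ?_⟩)) hz'
      · rintro rfl
        exact hv (labels_mono Set.subset_union_right hz')
      · rcases hX with rfl | rfl
        · exact Or.inl hz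
        · exact Or.inr hz
  induction h with
  | single K =>
    rw [Set.mem_singleton_iff] at hL
    subst hL
    have := node hc (single L₁) (single L₂)
      (fun z hz hz' => by rw [labels_singleton] at hz hz'; exact hc.inter z hz hz')
    rw [Set.sdiff_self, Set.empty_union]
    exact this
  | @node K K₁ K₂ m D₁ D₂ h h₁ h₂ hi ih₁ ih₂ =>
    rcases hL with hL | hL
    · exact key h h₁ h₂ hi hL hv (ih₁ hL)
    · rw [Set.union_comm D₁] at hv ⊢
      exact key h.symm h₂ h₁ (fun z hz hz' => hi z hz' hz) hL hv (ih₂ hL)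

/-- A leaf `x` of the decomposition tree is one part of a split of the decomposed graph, and the
other graphs form a decomposition of the other part. -/
lemma remove_leaf (h : Dec K D) {x y : LGraph α} (hx : x ∈ D) (hy : y ∈ D) (hne : x ≠ y)
    (hmx : m ∈ x.verts) (hmy : m ∈ y.verts)
    (hleaf : ∀ z ∈ D, z ≠ x → (x.verts ∩ z.verts).Nonempty → z = y) :
    ∃ K', IsComp K x K' m ∧ Dec K' (D \ {x}) := by
  obtain ⟨K₁, K₂, D₁, D₂, hc, h₁, h₂, hi, rfl, hx₁, hy₂⟩ := h.split_at hx hy hne hmx hmy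
  have hD₁ : D₁ = {x} := by
    by_contra hD₁
    obtain ⟨z, hz, hzx, hn⟩ := h₁.exists_neighbor hx₁ hD₁
    have := hleaf z (Or.inl hz) hzx hn
    exact disjoint_of_node hc h₁ hi hz (this ▸ hy₂)
  have := h₁.eq_of_singleton hD₁
  subst this
  refine ⟨K₂, hc, ?_⟩
  have hK₁ : K₁ ∉ D₂ := disjoint_of_node hc h₁ hi hx₁
  rwa [hD₁, Set.union_sdiff_left, Set.sdiff_singleton_eq_self hK₁]

/-- Two adjacent nodes of the decomposition tree can be merged into one. -/
lemma merge_at (h : Dec K D) {x y : LGraph α} (hx : x ∈ D) (hy : y ∈ D) (hne : x ≠ y)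
    (hmx : m ∈ x.verts) (hmy : m ∈ y.verts) :
    ∃ M : LGraph α, IsComp M x y m ∧ m ∉ labels (insert M (D \ {x, y})) ∧ M ∉ D ∧
      Dec K (insert M (D \ {x, y})) := by
  obtain ⟨K₁, K₂, D₁, D₂, hc, h₁, h₂, hi, rfl, hx₁, hy₂⟩ := h.split_at hx hy hne hmx hmy
  have hi' : ∀ z ∈ labels D₂, z ∈ labels D₁ → z = m := fun z hz hz' => hi z hz' hz
  have hx₂ : x ∉ D₂ := disjoint_of_node hc h₁ hi hx₁
  have hy₁ : y ∉ D₁ := disjoint_of_node hc.symm h₂ hi' hy₂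
  obtain ⟨X, hX, hXE⟩ := h₁.graft hc hx₁ hmx fun z hz hz' => hi z hz (h₂.verts_subset hz')
  obtain ⟨M, hM, hME⟩ := h₂.graft hX.symm hy₂ hmy fun z hz hz' => hi z (mem_labels hx₁ hz') hz
  have hd₂ := hME {M} (single M) fun z hz _ => by
    rw [labels_singleton] at hz
    exact ((hM.mem_iff z).1 hz).2
  have hd := hXE _ hd₂ fun z hz hz₁ => by
    rw [labels_union, labels_singleton] at hz
    rcases hz with hz | hz
    · exact Or.inl ((hi z hz₁ (labels_mono Set.sdiff_subset hz)) ▸ hmx)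
    · rcases ((hM.mem_iff z).1 hz).2 with hz | hz
      · exact Or.inl ((hi z hz₁ (mem_labels hy₂ hz)) ▸ hmx)
      · exact Or.inl hz
  have e : (D₁ \ {x}) ∪ ((D₂ \ {y}) ∪ {M}) = insert M ((D₁ ∪ D₂) \ {x, y}) := by
    ext L
    simp only [Set.mem_union, Set.mem_sdiff, Set.mem_singleton_iff, Set.mem_insert_iff]
    constructor
    · rintro (⟨hL, hLx⟩ | ⟨hL, hLy⟩ | hL)
      · exact Or.inr ⟨Or.inl hL, by rintro (e | rfl); exacts [hLx e, hy₁ hL]⟩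
      · exact Or.inr ⟨Or.inr hL, by rintro (rfl | e); exacts [hx₂ hL, hLy e]⟩
      · exact Or.inl hL
    · rintro (hL | ⟨hL | hL, hne'⟩)
      · exact Or.inr (Or.inr hL)
      · exact Or.inl ⟨hL, fun e => hne' (Or.inl e)⟩
      · exact Or.inr (Or.inl ⟨hL, fun e => hne' (Or.inr e)⟩)
  refine ⟨M, hM.symm, ?_, ?_, e ▸ hd⟩
  · rintro ⟨L, rfl | ⟨hL, hLn⟩, hmL⟩
    · exact hM.notMem hmL
    · rcases hL with hL | hL
      · exact hLn (Or.inl (h₁.eq_of_mem_verts hL hx₁ hmL hmx hc.left_mem))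
      · exact hLn (Or.inr (h₂.eq_of_mem_verts hL hy₂ hmL hmy hc.right_mem))
  · obtain ⟨a, ha, hane⟩ := hM.nontrivial_left.nonempty
    obtain ⟨b, hb, hbne⟩ := hM.nontrivial_right.nonempty
    rintro (hL | hL)
    · exact hane (hi a (mem_labels hL (hM.mem_left ha hane)) (mem_labels hy₂ ha))
    · exact hbne (hi b (mem_labels hx₁ hb) (mem_labels hL (hM.mem_right hb hbne)))

end Dec

/-! ### Connectivity -/

/-- Any two vertices of `S` are joined by a path of `K` inside `S`. -/
def ConnOn (K : LGraph α) (S : Set α) : Prop :=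
  ∀ x ∈ S, ∀ y ∈ S, Relation.ReflTransGen (fun s t => K.Adj s t ∧ s ∈ S ∧ t ∈ S) x y

lemma reach_symm {K : LGraph α} {P : α → Prop} {x y : α}
    (h : Relation.ReflTransGen (fun s t => K.Adj s t ∧ P s ∧ P t) x y) :
    Relation.ReflTransGen (fun s t => K.Adj s t ∧ P s ∧ P t) y x := by
  induction h with
  | refl => exact .refl
  | tail _ h ih => exact .head ⟨h.1.symm, h.2.2, h.2.1⟩ ih

lemma ConnOn.exists_adj {K : LGraph α} {S : Set α} (h : ConnOn K S) (hS : S.Nontrivial) {x : α}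
    (hx : x ∈ S) : ∃ z ∈ S, K.Adj x z := by
  obtain ⟨y, hy, hne⟩ := hS.exists_ne x
  obtain e | ⟨z, hz, -⟩ := (h x hx y hy).cases_head
  · exact absurd e.symm hne
  · exact ⟨z, hz.2.2, hz.1⟩

/-- If every vertex of `S` reaches `a` then `S` is connected. -/
lemma ConnOn.of_reach {K : LGraph α} {S : Set α} {a : α}
    (h : ∀ x ∈ S, Relation.ReflTransGen (fun s t => K.Adj s t ∧ s ∈ S ∧ t ∈ S) x a) :
    ConnOn K S :=
  fun x hx y hy => (h x hx).trans (reach_symm (h y hy))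

namespace IsComp

variable {K K₁ K₂ : LGraph α} {v : α}

/-- A part of a connected graph is connected: contract the other part to the marker. -/
lemma connOn_left (h : IsComp K K₁ K₂ v) (hK : ConnOn K K.verts) : ConnOn K₁ K₁.verts := by
  classical
  obtain ⟨k, hk, hkv⟩ := h.nontrivial_right.nonempty
  replace hkv : k ≠ v := hkv
  have hk₁ : k ∉ K₁.verts := fun hk' => hkv (h.inter _ hk' hk)
  let f : α → α := fun z => if z ∈ K₁.verts then z else v
  have hf : ∀ z, f z ∈ K₁.verts := fun z => by
    by_cases hz : z ∈ K₁.verts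
    · simp [f, hz]
    · simp [f, hz, h.left_mem]
  have step : ∀ s t, K.Adj s t → f s = f t ∨ K₁.Adj (f s) (f t) := by
    intro s t hst
    by_cases hs : s ∈ K₁.verts <;> by_cases ht : t ∈ K₁.verts <;> simp only [f, hs, ht, if_true,
      if_false]
    · exact Or.inr ((h.adj_left hs ht (fun e => h.notMem (e ▸ hst.fst_mem))
        (fun e => h.notMem (e ▸ hst.snd_mem))).1 hst)
    · obtain ⟨htv, ht'⟩ := (h.mem_iff t).1 hst.snd_mem
      exact Or.inr ((h.adj_cross hs (ht'.resolve_left ht) (fun e => h.notMem (e ▸ hst.fst_mem))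
        htv).1 hst).1
    · obtain ⟨hsv, hs'⟩ := (h.mem_iff s).1 hst.fst_mem
      exact Or.inr ((h.adj_cross ht (hs'.resolve_left hs) (fun e => h.notMem (e ▸ hst.snd_mem))
        hsv).1 hst.symm).1.symm
    · exact Or.inl trivial
  have path : ∀ s t, Relation.ReflTransGen (fun s t => K.Adj s t ∧ s ∈ K.verts ∧ t ∈ K.verts) s t →
      Relation.ReflTransGen (fun s t => K₁.Adj s t ∧ s ∈ K₁.verts ∧ t ∈ K₁.verts) (f s) (f t) := by
    intro s t hst
    induction hst with
    | refl => exact .refl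
    | @tail b c _ hbc ih =>
      rcases step b c hbc.1 with e | e
      · rwa [← e]
      · exact ih.tail ⟨e, hf _, hf _⟩
  have lift : ∀ z ∈ K₁.verts, ∃ z' ∈ K.verts, f z' = z := by
    intro z hz
    by_cases hzv : z = v
    · exact ⟨k, h.mem_right hk hkv, by simp [f, hk₁, hzv]⟩
    · exact ⟨z, h.mem_left hz hzv, by simp [f, hz]⟩
  intro x hx y hy
  obtain ⟨x', hx', rfl⟩ := lift x hx
  obtain ⟨y', hy', rfl⟩ := lift y hy
  exact path _ _ (hK x' hx' y' hy')

/-- The composition of two connected pieces containing the marker is connected. -/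
lemma connOn_of_parts (h : IsComp K K₁ K₂ v) {S₁ S₂ : Set α} (h₁ : ConnOn K₁ S₁)
    (h₂ : ConnOn K₂ S₂) (n₁ : S₁.Nontrivial) (n₂ : S₂.Nontrivial) (v₁ : v ∈ S₁) (v₂ : v ∈ S₂) :
    ConnOn K ((S₁ ∪ S₂) \ {v}) := by
  obtain ⟨a, ha, hva⟩ := h₁.exists_adj n₁ v₁
  obtain ⟨b, hb, hvb⟩ := h₂.exists_adj n₂ v₂
  have hab : K.Adj a b :=
    (h.adj_iff a b).2 ⟨hva.ne.symm, hvb.ne.symm, Or.inr (Or.inr (Or.inl ⟨hva.symm, hvb⟩))⟩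
  have haS : a ∈ (S₁ ∪ S₂) \ {v} := ⟨Or.inl ha, hva.ne.symm⟩
  have hbS : b ∈ (S₁ ∪ S₂) \ {v} := ⟨Or.inr hb, hvb.ne.symm⟩
  refine ConnOn.of_reach (a := a) ?_
  rintro x ⟨hx | hx, hxv⟩
  · have := h₁ x hx v v₁
    induction this using Relation.ReflTransGen.head_induction_on with
    | refl => exact absurd rfl hxv
    | @head s t hst _ ih =>
      have hsS : s ∈ (S₁ ∪ S₂) \ {v} := ⟨Or.inl hx, hxv⟩
      by_cases htv : t = v
      · subst htv
        exact .head ⟨(h.adj_iff s b).2 ⟨hxv, hvb.ne.symm, Or.inr (Or.inr (Or.inl ⟨hst.1, hvb⟩))⟩,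
          hsS, hbS⟩ (.single ⟨hab.symm, hbS, haS⟩)
      · exact .head ⟨(h.adj_iff s t).2 ⟨hxv, htv, Or.inl hst.1⟩, hsS, Or.inl hst.2.2, htv⟩
          (ih htv hst.2.2)
  · have := h₂ x hx v v₂
    induction this using Relation.ReflTransGen.head_induction_on with
    | refl => exact absurd rfl hxv
    | @head s t hst _ ih =>
      have hsS : s ∈ (S₁ ∪ S₂) \ {v} := ⟨Or.inr hx, hxv⟩
      by_cases htv : t = v
      · subst htv
        exact .single ⟨(h.adj_iff s a).2 ⟨hxv, hva.ne.symm,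
          Or.inr (Or.inr (Or.inr ⟨hst.1, hva⟩))⟩, hsS, haS⟩
      · exact .head ⟨(h.adj_iff s t).2 ⟨hxv, htv, Or.inr (Or.inl hst.1)⟩, hsS,
          Or.inr hst.2.2, htv⟩ (ih htv hst.2.2)

end IsComp

namespace Dec

variable {K : LGraph α} {D : Set (LGraph α)} {m : α}

lemma connOn_of_mem (h : Dec K D) (hK : ConnOn K K.verts) : ∀ L ∈ D, ConnOn L L.verts := by
  induction h with
  | single K => rintro L rfl; exact hK
  | node h _ _ _ ih₁ ih₂ =>
    rintro L (hL | hL)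
    · exact ih₁ (h.connOn_left hK) L hL
    · exact ih₂ (h.symm.connOn_left hK) L hL

/-- A vertex of `K` that is not a cut vertex of the graph of the decomposition containing it is not
a cut vertex of `K`. -/
lemma connOn_compl (h : Dec K D) (hK : ConnOn K K.verts) (hm : m ∈ K.verts) {P : LGraph α}
    (hP : P ∈ D) (hmP : m ∈ P.verts) (hconn : ConnOn P (P.verts \ {m})) :
    ConnOn K (K.verts \ {m}) := by
  have key : ∀ {K K₁ K₂ : LGraph α} {v : α}, IsComp K K₁ K₂ v → ConnOn K K.verts → m ∈ K.verts →
      m ∈ K₁.verts → ConnOn K₁ (K₁.verts \ {m}) → ConnOn K (K.verts \ {m}) := by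
    intro K K₁ K₂ v h hK hm hm₁ hc
    have hmv : m ≠ v := fun e => h.notMem (e ▸ hm)
    have := h.connOn_of_parts hc (h.symm.connOn_left hK) ?_ h.symm.verts_nontrivial_left
      ⟨h.left_mem, fun e => hmv e.symm⟩ h.right_mem
    · convert this using 1
      ext z
      simp only [Set.mem_sdiff, Set.mem_union, Set.mem_singleton_iff, h.mem_iff]
      have : z ∈ K₂.verts → z = m → z = v := fun hz e => h.inter z (e ▸ hm₁) hz
      have : z = m → z ≠ v := fun e => e ▸ hmv
      tauto
    · obtain ⟨z, hz, hzm⟩ := h.nontrivial_left.exists_ne m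
      exact ⟨z, ⟨hz.1, hzm⟩, v, ⟨h.left_mem, fun e => hmv e.symm⟩, hz.2⟩
  induction h with
  | single K =>
    rw [Set.mem_singleton_iff] at hP
    exact hP ▸ hconn
  | @node K K₁ K₂ v D₁ D₂ h h₁ h₂ hi ih₁ ih₂ =>
    have hmv : m ≠ v := fun e => h.notMem (e ▸ hm)
    rcases hP with hP | hP
    · have hm₁ : m ∈ K₁.verts := ((h.mem_iff m).1 hm).2.resolve_right
        fun hm₂ => hmv (hi m (mem_labels hP hmP) (h₂.verts_subset hm₂))
      exact key h hK hm hm₁ (ih₁ (h.connOn_left hK) hm₁ hP)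
    · have hm₂ : m ∈ K₂.verts := ((h.mem_iff m).1 hm).2.resolve_left
        fun hm₁ => hmv (hi m (h₁.verts_subset hm₁) (mem_labels hP hmP))
      exact key h.symm hK hm hm₂ (ih₂ (h.symm.connOn_left hK) hm₂ hP)

end Dec

/-! ### Split decompositions in terms of compositions -/

lemma isComp_of_isSimpleSplitDecomp {K K₁ K₂ : LGraph α} {v : α} (hK : ConnOn K K.verts)
    (h : IsSimpleSplitDecomp K v K₁ K₂) : IsComp K K₁ K₂ v := by
  obtain ⟨hv, V₁, V₂, hs, rfl, rfl⟩ := h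
  have hv₁ : v ∉ V₁ := fun h => hv (hs.union_eq ▸ Or.inl h)
  have hv₂ : v ∉ V₂ := fun h => hv (hs.union_eq ▸ Or.inr h)
  have hd : ∀ z, z ∈ V₁ → z ∉ V₂ := fun z h₁ h₂ => Set.disjoint_left.1 hs.disjoint h₁ h₂
  have hsub₁ : V₁ ⊆ K.verts := hs.union_eq ▸ Set.subset_union_left
  have hsub₂ : V₂ ⊆ K.verts := hs.union_eq ▸ Set.subset_union_right
  have hmem : ∀ z, z ∈ K.verts ↔ z ∈ V₁ ∨ z ∈ V₂ := fun z => by rw [← hs.union_eq]; rfl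
  -- a connected graph has an edge between the two sides of a split
  obtain ⟨a, ha, b, hb, hab⟩ : ∃ a ∈ V₁, ∃ b ∈ V₂, K.Adj a b := by
    by_contra hno
    push Not at hno
    obtain ⟨a, ha⟩ := hs.nontrivial_left.nonempty
    obtain ⟨b, hb⟩ := hs.nontrivial_right.nonempty
    have := hK a (hsub₁ ha) b (hsub₂ hb)
    have hb' : b ∈ V₁ := by
      clear hb
      induction this with
      | refl => exact ha
      | @tail s t _ hst ih => exact ((hmem t).1 hst.2.2).resolve_right fun ht => hno s ih t ht hst.1
    exact hd b hb' hb
  have hn₁ : ∀ z, z ∈ V₁ → (z ∈ nbhd K V₂ ↔ ∃ w ∈ V₂, K.Adj w z) := fun z hz =>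
    ⟨fun h => h.2, fun h => ⟨⟨hsub₁ hz, hd z hz⟩, h⟩⟩
  have hn₂ : ∀ z, z ∈ V₂ → (z ∈ nbhd K V₁ ↔ ∃ w ∈ V₁, K.Adj w z) := fun z hz =>
    ⟨fun h => h.2, fun h => ⟨⟨hsub₂ hz, fun h' => hd z h' hz⟩, h⟩⟩
  have d₁ : insert v V₁ \ {v} = V₁ := by
    rw [Set.insert_sdiff_self_of_notMem hv₁]
  have d₂ : insert v V₂ \ {v} = V₂ := by
    rw [Set.insert_sdiff_self_of_notMem hv₂]
  refine ⟨Set.mem_insert _ _, Set.mem_insert _ _, ?_, ?_, ?_, ⟨a, ?_⟩, ⟨b, ?_⟩, ?_, ?_⟩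
  · rintro z (h₁ | h₁) (h₂ | h₂)
    · exact h₁
    · exact h₁
    · exact h₂
    · exact absurd h₂ (hd z h₁)
  · exact d₁.symm ▸ hs.nontrivial_left
  · exact d₂.symm ▸ hs.nontrivial_right
  · exact ⟨fun e => hv₁ (e ▸ ha), Or.inr (Or.inl ⟨rfl, ha, (hn₁ a ha).2 ⟨b, hb, hab.symm⟩⟩)⟩
  · exact ⟨fun e => hv₂ (e ▸ hb), Or.inr (Or.inl ⟨rfl, hb, (hn₂ b hb).2 ⟨a, ha, hab⟩⟩)⟩
  · intro z
    rw [hmem]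
    change _ ↔ z ≠ v ∧ ((z = v ∨ z ∈ V₁) ∨ (z = v ∨ z ∈ V₂))
    have : z ∈ V₁ → z ≠ v := fun h e => hv₁ (e ▸ h)
    have : z ∈ V₂ → z ≠ v := fun h e => hv₂ (e ▸ h)
    tauto
  · intro x y
    by_cases hxv : x = v
    · subst hxv
      exact ⟨fun h => absurd h.fst_mem hv, fun h => absurd rfl h.1⟩
    by_cases hyv : y = v
    · subst hyv
      exact ⟨fun h => absurd h.snd_mem hv, fun h => absurd rfl h.2.1⟩
    have hne : K.Adj x y → x ≠ y := fun h => h.ne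
    have ha := hs.adj_iff x
    have hb := hs.adj_iff y
    have hx := hmem x
    have hy := hmem y
    have hx' : K.Adj x y → x ∈ K.verts := fun h => h.fst_mem
    have hy' : K.Adj x y → y ∈ K.verts := fun h => h.snd_mem
    have hc : K.Adj x y ↔ K.Adj y x := K.adj_comm x y
    have dx := hd x
    have dy := hd y
    have nx₁ : x ∈ nbhd K V₂ → x ∉ V₂ := fun h => h.1.2
    have nx₂ : x ∈ nbhd K V₁ → x ∉ V₁ := fun h => h.1.2
    simp only [withMarker]
    grind

lemma IsComp.isSimpleSplitDecomp {K K₁ K₂ : LGraph α} {v : α} (h : IsComp K K₁ K₂ v) :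
    IsSimpleSplitDecomp K v K₁ K₂ := by
  -- the vertices of a part adjacent to the other part are those adjacent to the marker
  have nb : ∀ {K₁ K₂ : LGraph α}, IsComp K K₁ K₂ v → ∀ x ∈ K₁.verts, x ≠ v →
      (x ∈ nbhd K (K₂.verts \ {v}) ↔ K₁.Adj x v) := by
    intro K₁ K₂ h x hx hxv
    constructor
    · rintro ⟨-, w, ⟨hw, hwv⟩, hwx⟩
      exact ((h.adj_cross hx hw hxv hwv).1 hwx.symm).1
    · intro hxa
      obtain ⟨b, hb⟩ := h.nbr_right
      exact ⟨⟨h.mem_left hx hxv, fun h' => hxv (h.inter x hx h'.1)⟩, b,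
        ⟨hb.snd_mem, hb.ne.symm⟩, ((h.adj_cross hx hb.snd_mem hxv hb.ne.symm).2 ⟨hxa, hb⟩).symm⟩
  have wm : ∀ {K₁ K₂ : LGraph α}, IsComp K K₁ K₂ v →
      K₁ = withMarker K (K₁.verts \ {v}) (K₂.verts \ {v}) v := by
    intro K₁ K₂ h
    ext x y
    · change _ ↔ x = v ∨ (x ∈ K₁.verts ∧ x ≠ v)
      have := h.left_mem
      constructor
      · tauto
      · rintro (rfl | h')
        · exact this
        · exact h'.1
    · simp only [withMarker, Set.mem_sdiff, Set.mem_singleton_iff]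
      constructor
      · intro hxy
        refine ⟨hxy.ne, ?_⟩
        by_cases hxv : x = v
        · subst hxv
          exact Or.inr (Or.inl ⟨rfl, ⟨hxy.snd_mem, hxy.ne.symm⟩,
            (nb h y hxy.snd_mem hxy.ne.symm).2 hxy.symm⟩)
        by_cases hyv : y = v
        · subst hyv
          exact Or.inr (Or.inr ⟨rfl, ⟨hxy.fst_mem, hxy.ne⟩, (nb h x hxy.fst_mem hxy.ne).2 hxy⟩)
        exact Or.inl ⟨⟨hxy.fst_mem, hxv⟩, ⟨hxy.snd_mem, hyv⟩,
          (h.adj_left hxy.fst_mem hxy.snd_mem hxv hyv).2 hxy⟩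
      · rintro ⟨-, ⟨hx, hy, hxy⟩ | ⟨rfl, hy, hn⟩ | ⟨rfl, hx, hn⟩⟩
        · exact (h.adj_left hx.1 hy.1 hx.2 hy.2).1 hxy
        · exact ((nb h y hy.1 hy.2).1 hn).symm
        · exact (nb h x hx.1 hx.2).1 hn
  refine ⟨h.notMem, K₁.verts \ {v}, K₂.verts \ {v}, ⟨?_, ?_, h.nontrivial_left,
    h.nontrivial_right, ?_⟩, wm h, wm h.symm⟩
  · ext z
    rw [h.mem_iff]
    simp only [Set.mem_union, Set.mem_sdiff, Set.mem_singleton_iff]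
    tauto
  · rw [Set.disjoint_left]
    rintro z ⟨hz, hzv⟩ ⟨hz', -⟩
    exact hzv (h.inter z hz hz')
  · rintro x ⟨hx, hxv⟩ y ⟨hy, hyv⟩
    rw [nb h x hx hxv, nb h.symm y hy hyv, h.adj_cross hx hy hxv hyv, K₂.adj_comm v y]

lemma Dec.of_isSplitDecomp {K : LGraph α} {D : Set (LGraph α)} (hK : ConnOn K K.verts)
    (h : IsSplitDecomp K D) : Dec K D := by
  induction h with
  | refl => exact .single K
  | tail _ h ih =>
    obtain ⟨L, hL, v, L₁, L₂, hv, hs, rfl⟩ := h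
    refine ih.refine_at hL (isComp_of_isSimpleSplitDecomp (ih.connOn_of_mem hK L hL) hs) ?_
    rintro ⟨X, hX, hvX⟩
    exact hv X hX hvX

lemma SplitStep.labels_subset {D D' : Set (LGraph α)} (h : SplitStep D D') :
    labels D ⊆ labels D' := by
  obtain ⟨L, hL, v, L₁, L₂, hv, ⟨-, V₁, V₂, hs, rfl, rfl⟩, rfl⟩ := h
  rintro z ⟨X, hX, hz⟩
  by_cases hXL : X = L
  · subst hXL
    rw [← hs.union_eq] at hz
    rcases hz with hz | hz
    · exact ⟨_, Or.inr (Or.inl rfl), Or.inr hz⟩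
    · exact ⟨_, Or.inr (Or.inr rfl), Or.inr hz⟩
  · exact ⟨X, Or.inl ⟨hX, hXL⟩, hz⟩

/-- Splitting steps can be carried out in the presence of further graphs. -/
lemma splitSteps_union {D D' E : Set (LGraph α)} {u : α} (h : Relation.ReflTransGen SplitStep D D')
    (hu : u ∈ labels D) (hi : ∀ z ∈ labels D', z ∈ labels E → z = u) :
    Relation.ReflTransGen SplitStep (D ∪ E) (D' ∪ E) := by
  induction h with
  | refl => exact .refl
  | @tail B C hB hstep ih =>
    have hBC := hstep.labels_subset
    have huB : u ∈ labels B := by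
      clear ih hi hstep hBC
      induction hB with
      | refl => exact hu
      | tail _ hs ih => exact hs.labels_subset ih
    refine (ih fun z hz hz' => hi z (hBC hz) hz').tail ?_
    obtain ⟨L, hL, v, L₁, L₂, hv, hd, rfl⟩ := hstep
    have hLE : L ∉ E := by
      intro hLE
      obtain ⟨-, V₁, V₂, hs, -⟩ := hd
      obtain ⟨z, hz, hzu⟩ := hs.nontrivial_left.exists_ne u
      have hzL : z ∈ L.verts := hs.union_eq ▸ Or.inl hz
      exact hzu (hi z (hBC ⟨L, hL, hzL⟩) ⟨L, hLE, hzL⟩)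
    refine ⟨L, Or.inl hL, v, L₁, L₂, ?_, hd, ?_⟩
    · rintro X (hX | hX) hvX
      · exact hv X hX hvX
      · have hvL : v ∈ L₁.verts := by
          obtain ⟨-, V₁, V₂, hs, rfl, rfl⟩ := hd
          exact Or.inl rfl
        have := hi v ⟨L₁, Or.inr (Or.inl rfl), hvL⟩ ⟨X, hX, hvX⟩
        subst this
        obtain ⟨Y, hY, hvY⟩ := huB
        exact hv Y hY hvY
    · rw [Set.union_sdiff_distrib, Set.sdiff_singleton_eq_self hLE, Set.union_right_comm]

lemma Dec.isSplitDecomp {K : LGraph α} {D : Set (LGraph α)} (h : Dec K D) : IsSplitDecomp K D := by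
  induction h with
  | single K => exact .refl
  | @node K K₁ K₂ v D₁ D₂ h h₁ h₂ hi ih₁ ih₂ =>
    have s₀ : SplitStep {K} ({K₁} ∪ {K₂}) := by
      refine ⟨K, rfl, v, K₁, K₂, ?_, h.isSimpleSplitDecomp, ?_⟩
      · rintro L rfl
        exact h.notMem
      · rw [Set.sdiff_self, Set.empty_union]
        rfl
    have s₁ : Relation.ReflTransGen SplitStep ({K₁} ∪ {K₂}) (D₁ ∪ {K₂}) :=
      splitSteps_union ih₁ (u := v) (by rw [labels_singleton]; exact h.left_mem) fun z hz hz' => by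
        rw [labels_singleton] at hz'
        exact hi z hz (h₂.verts_subset hz')
    have s₂ : Relation.ReflTransGen SplitStep ({K₂} ∪ D₁) (D₂ ∪ D₁) :=
      splitSteps_union ih₂ (u := v) (by rw [labels_singleton]; exact h.right_mem) fun z hz hz' =>
        hi z hz' hz
    rw [Set.union_comm {K₂}, Set.union_comm D₂] at s₂
    exact (s₁.trans s₂).head s₀

/-! ### Paths avoiding a closed neighbourhood -/

/-- `z` lies outside the closed neighbourhood of `u`. -/
def Far (K : LGraph α) (u z : α) : Prop := z ≠ u ∧ ¬ K.Adj u z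

/-- `x` and `y` are equal or joined by a path of `K - N[u]`. -/
def FarReach (K : LGraph α) (u x y : α) : Prop :=
  Relation.ReflTransGen (fun s t => K.Adj s t ∧ Far K u s ∧ Far K u t) x y

/-- `K` has an asteroidal triple. -/
def HasAT (K : LGraph α) : Prop :=
  ∃ a b c, a ≠ b ∧ b ≠ c ∧ a ≠ c ∧ FarReach K a b c ∧ FarReach K b a c ∧ FarReach K c a b

/-- The property of distance hereditary graphs used in the argument: two vertices at distance two
from `u` that are joined by a path of `K - N[u]` have the same neighbours in `N(u)`. -/
def LevelTwins (K : LGraph α) : Prop :=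
  ∀ u a b x y, K.Adj u a → K.Adj u b → K.Adj a x → K.Adj b y → FarReach K u x y → K.Adj a y

lemma FarReach.symm {K : LGraph α} {u x y : α} (h : FarReach K u x y) : FarReach K u y x :=
  reach_symm h

lemma FarReach.far {K : LGraph α} {u x y : α} (h : FarReach K u x y) (hx : Far K u x) :
    Far K u y := by
  obtain e | ⟨z, -, hz⟩ := Relation.ReflTransGen.cases_tail h
  · exact e ▸ hx
  · exact hz.2.2

/-- `K'` is isomorphic to an induced subgraph of `K`. -/
def Embeds (K' K : LGraph α) : Prop :=
  ∃ φ : α → α, Set.InjOn φ K'.verts ∧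
    ∀ x ∈ K'.verts, ∀ y ∈ K'.verts, K.Adj (φ x) (φ y) ↔ K'.Adj x y

lemma farReach_map {K K' : LGraph α} {φ : α → α} (hinj : Set.InjOn φ K'.verts)
    (hadj : ∀ x ∈ K'.verts, ∀ y ∈ K'.verts, K.Adj (φ x) (φ y) ↔ K'.Adj x y) {u x y : α}
    (hu : u ∈ K'.verts) (h : FarReach K' u x y) : FarReach K (φ u) (φ x) (φ y) := by
  induction h with
  | refl => exact .refl
  | @tail s t _ hst ih =>
    obtain ⟨hst, ⟨h₁, h₂⟩, h₃, h₄⟩ := hst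
    have hs := hst.fst_mem
    have ht := hst.snd_mem
    refine ih.tail ⟨(hadj s hs t ht).2 hst, ⟨fun e => h₁ (hinj hs hu e), ?_⟩,
      fun e => h₃ (hinj ht hu e), ?_⟩
    · rwa [hadj u hu s hs]
    · rwa [hadj u hu t ht]

lemma Embeds.levelTwins {K K' : LGraph α} (h : Embeds K' K) (hK : LevelTwins K) :
    LevelTwins K' := by
  obtain ⟨φ, hinj, hadj⟩ := h
  intro u a b x y hua hub hax hby hr
  have hu := hua.fst_mem
  have ha := hua.snd_mem
  have hb := hub.snd_mem
  have hx := hax.snd_mem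
  have hy := hby.snd_mem
  rw [← hadj a ha y hy]
  exact hK _ _ (φ b) (φ x) _ ((hadj u hu a ha).2 hua) ((hadj u hu b hb).2 hub)
    ((hadj a ha x hx).2 hax) ((hadj b hb y hy).2 hby) (farReach_map hinj hadj hu hr)

lemma FarReach.mem {K : LGraph α} {u x y : α} (h : FarReach K u x y) (hne : x ≠ y) :
    x ∈ K.verts ∧ y ∈ K.verts := by
  constructor
  · obtain e | ⟨z, hz, -⟩ := Relation.ReflTransGen.cases_head h
    · exact absurd e hne
    · exact hz.1.fst_mem
  · obtain e | ⟨z, -, hz⟩ := Relation.ReflTransGen.cases_tail h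
    · exact absurd e.symm hne
    · exact hz.1.snd_mem

lemma Embeds.hasAT {K K' : LGraph α} (h : Embeds K' K) (hK : HasAT K') : HasAT K := by
  obtain ⟨φ, hinj, hadj⟩ := h
  obtain ⟨a, b, c, hab, hbc, hac, h₁, h₂, h₃⟩ := hK
  obtain ⟨hb, hc⟩ := h₁.mem hbc
  obtain ⟨ha, -⟩ := h₂.mem hac
  exact ⟨φ a, φ b, φ c, fun e => hab (hinj ha hb e), fun e => hbc (hinj hb hc e),
    fun e => hac (hinj ha hc e), farReach_map hinj hadj ha h₁, farReach_map hinj hadj hb h₂,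
    farReach_map hinj hadj hc h₃⟩

/-- A part of a split embeds: its marker is represented by a vertex of the other part. -/
lemma IsComp.embeds_left {K K₁ K₂ : LGraph α} {v : α} (h : IsComp K K₁ K₂ v) : Embeds K₁ K := by
  classical
  obtain ⟨b, hb⟩ := h.nbr_right
  have hbv : b ≠ v := hb.ne.symm
  have hb₁ : b ∉ K₁.verts := fun h' => hbv (h.inter b h' hb.snd_mem)
  have cross : ∀ y ∈ K₁.verts, y ≠ v → (K.Adj b y ↔ K₁.Adj v y) := by
    intro y hy hyv
    rw [K.adj_comm, h.adj_cross hy hb.snd_mem hyv hbv, K₁.adj_comm]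
    exact and_iff_left hb
  refine ⟨fun z => if z = v then b else z, ?_, ?_⟩
  · intro x hx y hy hxy
    by_cases hxv : x = v <;> by_cases hyv : y = v <;> simp only [hxv, hyv, if_true, if_false] at hxy
    · rw [hxv, hyv]
    · exact absurd (hxy ▸ hy) hb₁
    · exact absurd (hxy ▸ hx) hb₁
    · exact hxy
  · intro x hx y hy
    by_cases hxv : x = v <;> by_cases hyv : y = v <;> simp only [hxv, hyv, if_true, if_false]
    · exact ⟨fun h => absurd rfl h.ne, fun h => absurd rfl h.ne⟩
    · exact cross y hy hyv
    · rw [K.adj_comm, cross x hx hxv, K₁.adj_comm]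
    · exact h.adj_left hx hy hxv hyv

lemma Dec.levelTwins_of_mem {K : LGraph α} {D : Set (LGraph α)} (h : Dec K D)
    (hK : LevelTwins K) : ∀ L ∈ D, LevelTwins L := by
  induction h with
  | single K => rintro L rfl; exact hK
  | node h _ _ _ ih₁ ih₂ =>
    rintro L (hL | hL)
    · exact ih₁ (h.embeds_left.levelTwins hK) L hL
    · exact ih₂ (h.symm.embeds_left.levelTwins hK) L hL

/-! ### Prime distance hereditary graphs -/

/-- A connected prime graph with the property of distance hereditary graphs above is a clique or a
star. If `u` and `v` are non-adjacent and `v` has a neighbour outside `N[u]`, then the component of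
`v` in `L - N[u]` is one side of a split. Otherwise `u` and `v` have the same neighbours, and
`{u, v}` is one side of a split unless only one further vertex is left. -/
lemma isCliqueGraph_or_isStar_of_isPrime {L : LGraph α} (hL : ConnOn L L.verts)
    (hQ : LevelTwins L) (hp : IsPrime L) : IsCliqueGraph L ∨ IsStar L := by
  by_contra hno
  push Not at hno
  obtain ⟨hcl, hst⟩ := hno
  obtain ⟨u, hu, v, hv, huv, hnadj⟩ : ∃ u ∈ L.verts, ∃ v ∈ L.verts, u ≠ v ∧ ¬ L.Adj u v := by
    simpa [IsCliqueGraph] using hcl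
  have key : ∀ u ∈ L.verts, ∀ v ∈ L.verts, u ≠ v → ¬ L.Adj u v → ∀ w, L.Adj v w → L.Adj u w := by
    intro u hu v hv huv hnadj w hvw
    by_contra huw
    have fv : Far L u v := ⟨huv.symm, hnadj⟩
    have fw : Far L u w := ⟨fun e => hnadj (e ▸ hvw.symm), huw⟩
    obtain ⟨a, ha, hua⟩ := hL.exists_adj ⟨u, hu, v, hv, huv⟩ hu
    have hC : ∀ z, FarReach L u v z → Far L u z := fun z hz => hz.far fv
    have hCv : ∀ z, FarReach L u v z → z ∈ L.verts := fun z hz => by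
      by_cases e : v = z
      · exact e ▸ hv
      · exact (hz.mem e).2
    -- a vertex outside the component but adjacent to it is a neighbour of `u`
    have hout : ∀ x z, FarReach L u v x → ¬ FarReach L u v z → L.Adj x z → L.Adj u z := by
      intro x z hx hz hxz
      by_contra huz
      refine hz (Relation.ReflTransGen.tail hx ⟨hxz, hC x hx, ?_, huz⟩)
      rintro rfl
      exact (hC x hx).2 hxz.symm
    refine hp ⟨{z | FarReach L u v z}, {z | z ∈ L.verts ∧ ¬ FarReach L u v z}, ?_, ?_, ?_, ?_, ?_⟩
    · ext z
      have := hCv z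
      simp only [Set.mem_union, Set.mem_ofPred_eq]
      tauto
    · rw [Set.disjoint_left]
      rintro z hz ⟨-, hz'⟩
      exact hz' hz
    · exact ⟨v, .refl, w, .single ⟨hvw, fv, fw⟩, hvw.ne⟩
    · exact ⟨u, ⟨hu, fun h => (hC u h).1 rfl⟩, a, ⟨ha, fun h => (hC a h).2 hua⟩, hua.ne⟩
    · rintro x hx y ⟨hyL, hy⟩
      constructor
      · intro hxy
        exact ⟨⟨⟨hCv x hx, fun h => h.2 hx⟩, y, ⟨hyL, hy⟩, hxy.symm⟩, ⟨hyL, hy⟩, x, hx, hxy⟩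
      · rintro ⟨⟨-, a, ⟨-, ha⟩, hax⟩, -, x', hx', hx'y⟩
        have hx : FarReach L u v x := hx
        have hx' : FarReach L u v x' := hx'
        exact (hQ u y a x' x (hout x' y hx' hy hx'y) (hout x a hx ha hax.symm) hx'y.symm hax
          (hx'.symm.trans hx)).symm
  have h₁ := key u hu v hv huv hnadj
  have h₂ := key v hv u hu huv.symm (fun h => hnadj h.symm)
  obtain ⟨c, hc, huc⟩ := hL.exists_adj ⟨u, hu, v, hv, huv⟩ hu
  have hcv : c ≠ v := fun e => hnadj (e ▸ huc)
  have hcR : c ∈ L.verts \ {u, v} := ⟨hc, by rintro (e | e); exacts [huc.ne e.symm, hcv e]⟩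
  by_cases hR : (L.verts \ {u, v}).Nontrivial
  · refine hp ⟨{u, v}, L.verts \ {u, v}, ?_, Set.disjoint_sdiff_right,
      ⟨u, Or.inl rfl, v, Or.inr rfl, huv⟩, hR, ?_⟩
    · rw [Set.union_sdiff_self]
      refine Set.union_eq_right.2 ?_
      rintro z (rfl | rfl)
      exacts [hu, hv]
    · rintro x hx y hy
      have hxL : x ∈ L.verts := by rcases hx with rfl | rfl; exacts [hu, hv]
      constructor
      · intro hxy
        exact ⟨⟨⟨hxL, fun h => h.2 hx⟩, y, hy, hxy.symm⟩, hy, x, hx, hxy⟩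
      · rintro ⟨-, -, x', hx', hx'y⟩
        rcases hx with rfl | rfl <;> rcases hx' with rfl | rfl
        · exact hx'y
        · exact h₁ y hx'y
        · exact h₂ y hx'y
        · exact hx'y
  · rw [Set.not_nontrivial_iff] at hR
    have huniq : ∀ z ∈ L.verts, z = u ∨ z = v ∨ z = c := by
      intro z hz
      by_contra hne
      push Not at hne
      exact hne.2.2 (hR ⟨hz, by rintro (e | e); exacts [hne.1 e, hne.2.1 e]⟩ hcR)
    refine hst ⟨c, hc, fun x hx y hy => ⟨fun h => ⟨h.ne, ?_⟩, ?_⟩⟩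
    · have hvu : ¬ L.Adj v u := fun h => hnadj h.symm
      rcases huniq x hx with rfl | rfl | rfl
      · rcases huniq y hy with rfl | rfl | rfl
        · exact absurd rfl h.ne
        · exact absurd h hnadj
        · exact Or.inr rfl
      · rcases huniq y hy with rfl | rfl | rfl
        · exact absurd h hvu
        · exact absurd rfl h.ne
        · exact Or.inr rfl
      · exact Or.inl rfl
    · have hvc := h₂ c huc
      rintro ⟨hne, rfl | rfl⟩
      · rcases huniq y hy with rfl | rfl | rfl
        · exact huc.symm
        · exact hvc.symm
        · exact absurd rfl hne
      · rcases huniq x hx with rfl | rfl | rfl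
        · exact huc
        · exact hvc
        · exact absurd rfl hne

/-! ### Distance hereditary graphs -/

section Graph

variable {V : Type*} {G : SimpleGraph V}

lemma toLGraph_adj {u v : V} : (toLGraph G).Adj (Sum.inl u) (Sum.inl v) ↔ G.Adj u v := by
  constructor
  · rintro ⟨u', v', hu, hv, h⟩
    rw [Sum.inl.injEq] at hu hv
    rwa [hu, hv]
  · exact fun h => ⟨u, v, rfl, rfl, h⟩

lemma mem_toLGraph (v : V) : (Sum.inl v : V ⊕ ℕ) ∈ (toLGraph G).verts := ⟨v, rfl⟩

lemma connOn_toLGraph (hG : G.Connected) : ConnOn (toLGraph G) (toLGraph G).verts := by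
  rintro _ ⟨x, rfl⟩ _ ⟨y, rfl⟩
  obtain ⟨p⟩ := hG.preconnected x y
  induction p with
  | nil => exact .refl
  | cons h _ ih => exact ih.head ⟨toLGraph_adj.2 h, mem_toLGraph _, mem_toLGraph _⟩

lemma far_toLGraph {u z : V} :
    Far (toLGraph G) (Sum.inl u) (Sum.inl z) ↔ z ≠ u ∧ ¬ G.Adj u z := by
  rw [Far, toLGraph_adj, Ne, Sum.inl.injEq]

lemma farReach_toLGraph {u x : V} {y : V ⊕ ℕ}
    (h : FarReach (toLGraph G) (Sum.inl u) (Sum.inl x) y) :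
    ∃ y', y = Sum.inl y' ∧ Relation.ReflTransGen (fun s t => G.Adj s t ∧ (s ≠ u ∧ ¬ G.Adj u s) ∧
      t ≠ u ∧ ¬ G.Adj u t) x y' := by
  induction h with
  | refl => exact ⟨x, rfl, .refl⟩
  | tail _ hst ih =>
    obtain ⟨s, rfl, hs⟩ := ih
    obtain ⟨t, rfl⟩ := hst.1.snd_mem
    exact ⟨t, rfl, hs.tail ⟨toLGraph_adj.1 hst.1, far_toLGraph.1 hst.2.1, far_toLGraph.1 hst.2.2⟩⟩

lemma exists_adj_adj_of_length_le_two {u y : V} (p : G.Walk u y) (hp : p.length ≤ 2) (hne : u ≠ y)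
    (hn : ¬ G.Adj u y) : ∃ z, G.Adj u z ∧ G.Adj z y := by
  match p, hp with
  | .nil, _ => exact absurd rfl hne
  | .cons h .nil, _ => exact absurd h hn
  | .cons (v := z) h₁ (.cons h₂ .nil), _ => exact ⟨z, h₁, h₂⟩
  | .cons _ (.cons _ (.cons _ q)), hp =>
    simp only [SimpleGraph.Walk.length_cons] at hp
    omega

/-- In the connected induced subgraph on `u`, `a` and a connected set `C ∋ x, y` of vertices outside
`N[u]`, the vertex `a` is the only neighbour of `u`, hence is adjacent to `y`, which has distance
two from `u`. -/
lemma IsDistanceHereditary.adj_of_reach (hG : IsDistanceHereditary G) {u a b x y : V}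
    (hua : G.Adj u a) (hub : G.Adj u b) (hax : G.Adj a x) (hby : G.Adj b y)
    (h : Relation.ReflTransGen (fun s t => G.Adj s t ∧ (s ≠ u ∧ ¬ G.Adj u s) ∧
      t ≠ u ∧ ¬ G.Adj u t) x y) : G.Adj a y := by
  by_cases hxy : x = y
  · exact hxy ▸ hax
  set R := fun s t => G.Adj s t ∧ (s ≠ u ∧ ¬ G.Adj u s) ∧ t ≠ u ∧ ¬ G.Adj u t with hR
  have hx : x ≠ u ∧ ¬ G.Adj u x := by
    obtain e | ⟨z, hz, -⟩ := h.cases_head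
    · exact absurd e hxy
    · exact hz.2.1
  have hfar : ∀ z, Relation.ReflTransGen R x z → z ≠ u ∧ ¬ G.Adj u z := by
    intro z hz
    obtain e | ⟨w, -, hw⟩ := hz.cases_tail
    · exact e ▸ hx
    · exact hw.2.2
  let S : Set V := {z | z = u ∨ z = a ∨ Relation.ReflTransGen R x z}
  let u' : S := ⟨u, Or.inl rfl⟩
  let a' : S := ⟨a, Or.inr (Or.inl rfl)⟩
  have hreach : ∀ z (hz : Relation.ReflTransGen R x z),
      (G.induce S).Reachable u' ⟨z, Or.inr (Or.inr hz)⟩ := by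
    intro z hz
    induction hz with
    | refl =>
      have h₁ : (G.induce S).Adj u' a' := hua
      have h₂ : (G.induce S).Adj a' ⟨x, Or.inr (Or.inr .refl)⟩ := hax
      exact h₁.reachable.trans h₂.reachable
    | @tail s t hs hst ih =>
      have h₁ : (G.induce S).Adj ⟨s, Or.inr (Or.inr hs)⟩ ⟨t, Or.inr (Or.inr (hs.tail hst))⟩ := hst.1
      exact ih.trans h₁.reachable
  have hconn : (G.induce S).Connected := by
    rw [SimpleGraph.connected_iff_exists_forall_reachable]
    refine ⟨u', ?_⟩
    rintro ⟨z, rfl | rfl | hz⟩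
    · exact SimpleGraph.Reachable.refl _
    · have h₁ : (G.induce S).Adj u' a' := hua
      exact h₁.reachable
    · exact hreach z hz
  let y' : S := ⟨y, Or.inr (Or.inr h)⟩
  have hd : (G.induce S).dist u' y' ≤ 2 := by
    rw [hG S hconn u' y']
    exact SimpleGraph.dist_le (.cons hub (.cons hby .nil))
  obtain ⟨p, hp⟩ := hconn.exists_walk_length_eq_dist u' y'
  rw [← hp] at hd
  have hy := hfar y h
  obtain ⟨⟨z, hz⟩, h₁, h₂⟩ := exists_adj_adj_of_length_le_two p hd
    (fun e => hy.1 (congrArg Subtype.val e).symm) (fun h => hy.2 h)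
  have h₁ : G.Adj u z := h₁
  have h₂ : G.Adj z y := h₂
  rcases hz with rfl | rfl | hz
  · exact absurd rfl h₁.ne
  · exact h₂
  · exact absurd h₁ (hfar z hz).2

lemma IsDistanceHereditary.levelTwins (hG : IsDistanceHereditary G) : LevelTwins (toLGraph G) := by
  intro u a b x y hua hub hax hby hr
  obtain ⟨u, rfl⟩ := hua.fst_mem
  obtain ⟨a, rfl⟩ := hua.snd_mem
  obtain ⟨b, rfl⟩ := hub.snd_mem
  obtain ⟨x, rfl⟩ := hax.snd_mem
  obtain ⟨y', e, hr'⟩ := farReach_toLGraph hr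
  subst e
  rw [toLGraph_adj] at hua hub hax hby ⊢
  exact hG.adj_of_reach hua hub hax hby hr'

lemma not_isATFree_of_hasAT (h : HasAT (toLGraph G)) : ¬ IsATFree G := by
  classical
  intro hfree
  obtain ⟨a, b, c, hab, hbc, hac, h₁, h₂, h₃⟩ := h
  obtain ⟨⟨b, rfl⟩, ⟨c, rfl⟩⟩ := h₁.mem hbc
  obtain ⟨⟨a, rfl⟩, -⟩ := h₂.mem hac
  have walk : ∀ {a x y : V}, x ≠ y → FarReach (toLGraph G) (Sum.inl a) (Sum.inl x) (Sum.inl y) →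
      (∃ p : G.Walk x y, p.IsPath ∧ ∀ z ∈ p.support, z ≠ a ∧ ¬ G.Adj a z) := by
    intro a x y hxy h
    obtain ⟨y', e, hr⟩ := farReach_toLGraph h
    rw [Sum.inl.injEq] at e
    subst e
    have hx : x ≠ a ∧ ¬ G.Adj a x := by
      obtain e | ⟨z, hz, -⟩ := hr.cases_head
      · exact absurd e hxy
      · exact hz.2.1
    suffices ∃ p : G.Walk x y, ∀ z ∈ p.support, z ≠ a ∧ ¬ G.Adj a z by
      obtain ⟨p, hp⟩ := this
      exact ⟨p.bypass, p.bypass_isPath, fun z hz => hp z (p.support_bypass_subset_support hz)⟩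
    clear hxy h
    induction hr with
    | refl => exact ⟨.nil, by simpa using hx⟩
    | tail _ hst ih =>
      obtain ⟨p, hp⟩ := ih
      refine ⟨p.concat hst.1, fun z hz => ?_⟩
      rw [SimpleGraph.Walk.support_concat, List.mem_append, List.mem_singleton] at hz
      rcases hz with hz | rfl
      · exact hp z hz
      · exact hst.2.2
  have triv : ∀ {a x y : V}, x ≠ y → FarReach (toLGraph G) (Sum.inl a) (Sum.inl x) (Sum.inl y) →
      (∃ p : G.Walk x x, p.IsPath ∧ ∀ z ∈ p.support, z ≠ a ∧ ¬ G.Adj a z) := by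
    intro a x y hxy h
    obtain ⟨p, -, hp⟩ := walk hxy h
    refine ⟨.nil, .nil, ?_⟩
    simpa using hp x p.start_mem_support
  have nab : a ≠ b := fun e => hab (by rw [e])
  have nbc : b ≠ c := fun e => hbc (by rw [e])
  have nac : a ≠ c := fun e => hac (by rw [e])
  refine hfree ⟨{a, b, c}, Finset.card_eq_three.2 ⟨a, b, c, nab, nac, nbc, rfl⟩, ?_⟩
  intro z hz x hx y hy hxz hyz
  simp only [Finset.mem_insert, Finset.mem_singleton] at hz hx hy
  rcases hz with rfl | rfl | rfl <;> rcases hx with rfl | rfl | rfl <;>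
    rcases hy with rfl | rfl | rfl
  all_goals first
    | exact absurd rfl hxz
    | exact absurd rfl hyz
    | exact walk nbc h₁
    | exact walk nbc.symm h₁.symm
    | exact triv nbc h₁
    | exact triv nbc.symm h₁.symm
    | exact walk nac h₂
    | exact walk nac.symm h₂.symm
    | exact triv nac h₂
    | exact triv nac.symm h₂.symm
    | exact walk nab h₃
    | exact walk nab.symm h₃.symm
    | exact triv nab h₃
    | exact triv nab.symm h₃.symm

end Graph

/-! ### Leaves of the decomposition tree -/

/-- `x` is a leaf of the tree of `D`, with neighbour `y`. -/
structure IsLeafOf (D : Set (LGraph α)) (x y : LGraph α) : Prop where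
  mem : x ∈ D
  mem' : y ∈ D
  ne : x ≠ y
  meet : (x.verts ∩ y.verts).Nonempty
  unique : ∀ z ∈ D, z ≠ x → (x.verts ∩ z.verts).Nonempty → z = y

lemma Dec.exists_leaf {K : LGraph α} {D : Set (LGraph α)} (h : Dec K D) {N : LGraph α}
    (hN : N ∈ D) (hD : D ≠ {N}) : ∃ x y, IsLeafOf D x y ∧ x ≠ N := by
  have key : ∀ {N K K₁ K₂ : LGraph α} {v : α} {D₁ D₂ : Set (LGraph α)}, IsComp K K₁ K₂ v →
      Dec K₁ D₁ → Dec K₂ D₂ → (∀ z ∈ labels D₁, z ∈ labels D₂ → z = v) → N ∈ D₁ →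
      (∀ {N : LGraph α}, N ∈ D₂ → D₂ ≠ {N} → ∃ x y, IsLeafOf D₂ x y ∧ x ≠ N) →
      ∃ x y, IsLeafOf (D₁ ∪ D₂) x y ∧ x ≠ N := by
    intro N K K₁ K₂ v D₁ D₂ h h₁ h₂ hi hN ih
    obtain ⟨N₁, hN₁, hv₁⟩ := h₁.exists_mem_verts h.left_mem
    obtain ⟨N₂, hN₂, hv₂⟩ := h₂.exists_mem_verts h.right_mem
    have hdisj : ∀ {L}, L ∈ D₁ → L ∉ D₂ := fun hL => disjoint_of_node h h₁ hi hL
    by_cases hD₂ : D₂ = {N₂}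
    · refine ⟨N₂, N₁, ⟨Or.inr hN₂, Or.inl hN₁, ?_, ⟨v, hv₂, hv₁⟩, ?_⟩, ?_⟩
      · rintro rfl
        exact hdisj hN₁ hN₂
      · rintro z (hz | hz) hne ⟨a, ha₂, haz⟩
        · have := hi a (mem_labels hz haz) (mem_labels hN₂ ha₂)
          subst this
          exact h₁.eq_of_mem_verts hz hN₁ haz hv₁ h.left_mem
        · rw [hD₂] at hz
          exact absurd hz hne
      · rintro rfl
        exact hdisj hN hN₂
    · obtain ⟨x, y, hx, hne⟩ := ih hN₂ hD₂
      refine ⟨x, y, ⟨Or.inr hx.mem, Or.inr hx.mem', hx.ne, hx.meet, ?_⟩, ?_⟩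
      · rintro z (hz | hz) hzx hzm
        · obtain ⟨a, hax, haz⟩ := hzm
          have := hi a (mem_labels hz haz) (mem_labels hx.mem hax)
          subst this
          exact absurd (h₂.eq_of_mem_verts hx.mem hN₂ hax hv₂ h.right_mem) hne
        · exact hx.unique z hz hzx hzm
      · rintro rfl
        exact hdisj hN hx.mem
  induction h generalizing N with
  | single K =>
    rw [Set.mem_singleton_iff] at hN
    exact absurd (by rw [hN]) hD
  | @node K K₁ K₂ v D₁ D₂ h h₁ h₂ hi ih₁ ih₂ =>
    rcases hN with hN | hN
    · exact key h h₁ h₂ hi hN ih₂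
    · rw [Set.union_comm]
      exact key h.symm h₂ h₁ (fun z hz hz' => hi z hz' hz) hN ih₁

lemma Dec.finite {K : LGraph α} {D : Set (LGraph α)} (h : Dec K D) : D.Finite := by
  induction h with
  | single K => exact Set.finite_singleton K
  | node _ _ _ _ ih₁ ih₂ => exact ih₁.union ih₂

lemma Dec.remove_leafOf {K : LGraph α} {D : Set (LGraph α)} (h : Dec K D) {x y : LGraph α}
    (hx : IsLeafOf D x y) {m : α} (hmx : m ∈ x.verts) (hmy : m ∈ y.verts) :
    ∃ K', IsComp K x K' m ∧ Dec K' (D \ {x}) :=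
  h.remove_leaf hx.mem hx.mem' hx.ne hmx hmy hx.unique

/-! ### Decomposition trees that are paths -/

/-- `f 0, …, f (n - 1)` are the graphs of `D`, in the order of a path. -/
structure PathEnum (D : Set (LGraph α)) (n : ℕ) (f : ℕ → LGraph α) : Prop where
  bij : Set.BijOn f (Set.Iio n) D
  meet_iff : ∀ i < n, ∀ j < n, i ≠ j →
    (((f i).verts ∩ (f j).verts).Nonempty ↔ i + 1 = j ∨ j + 1 = i)

namespace PathEnum

variable {D : Set (LGraph α)} {n : ℕ} {f : ℕ → LGraph α}

lemma ne (h : PathEnum D n f) {i j : ℕ} (hi : i < n) (hj : j < n) (hij : i ≠ j) : f i ≠ f j :=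
  fun e => hij (h.bij.injOn hi hj e)

lemma reverse (h : PathEnum D n f) : PathEnum D n (fun i => f (n - 1 - i)) where
  bij := by
    refine ⟨fun i hi => h.bij.mapsTo ?_, fun i hi j hj e => ?_, fun x hx => ?_⟩
    · simp only [Set.mem_Iio] at hi ⊢
      omega
    · simp only [Set.mem_Iio] at hi hj
      have := h.bij.injOn (show n - 1 - i ∈ Set.Iio n by simp only [Set.mem_Iio]; omega)
        (show n - 1 - j ∈ Set.Iio n by simp only [Set.mem_Iio]; omega) e
      omega
    · obtain ⟨i, hi, rfl⟩ := h.bij.surjOn hx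
      simp only [Set.mem_Iio] at hi
      refine ⟨n - 1 - i, ?_, ?_⟩
      · simp only [Set.mem_Iio]
        omega
      · change f (n - 1 - (n - 1 - i)) = f i
        congr 1
        omega
  meet_iff := by
    intro i hi j hj hij
    rw [h.meet_iff _ (by omega) _ (by omega) (by omega)]
    omega

lemma leaf_last (h : PathEnum D n f) (hn : 2 ≤ n) : IsLeafOf D (f (n - 1)) (f (n - 2)) where
  mem := h.bij.mapsTo (show n - 1 < n by omega)
  mem' := h.bij.mapsTo (show n - 2 < n by omega)
  ne := h.ne (by omega) (by omega) (by omega)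
  meet := (h.meet_iff _ (by omega) _ (by omega) (by omega)).2 (by omega)
  unique := by
    intro z hz hne hm
    obtain ⟨i, hi, rfl⟩ := h.bij.surjOn hz
    have hi : i < n := hi
    have hin : n - 1 ≠ i := by
      rintro rfl
      exact hne rfl
    have := (h.meet_iff _ (by omega) _ hi hin).1 hm
    congr 1
    omega

lemma leaf_first (h : PathEnum D n f) (hn : 2 ≤ n) : ∃ y, IsLeafOf D (f 0) y := by
  have := h.reverse.leaf_last hn
  rw [show n - 1 - (n - 1) = 0 by omega] at this
  exact ⟨_, this⟩

/-- A path can be extended at its end. -/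
lemma extend (h : PathEnum D n f) (hn : 1 ≤ n) {x : LGraph α} (hx : x ∉ D)
    (hm : ∀ z ∈ D, (x.verts ∩ z.verts).Nonempty ↔ z = f (n - 1)) :
    ∃ g, PathEnum (insert x D) (n + 1) g := by
  have hlt : ∀ i < n, Function.update f n x i = f i := fun i hi =>
    Function.update_of_ne (by omega) _ _
  have heq : Function.update f n x n = x := Function.update_self _ _ _
  have hmem : ∀ i < n, f i ∈ D := fun i hi => h.bij.mapsTo hi
  have hmi : ∀ i < n, (x.verts ∩ (f i).verts).Nonempty ↔ i + 1 = n := by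
    intro i hi
    rw [hm _ (hmem i hi)]
    constructor
    · intro e
      have := h.bij.injOn hi (show n - 1 < n by omega) e
      omega
    · intro e
      congr 1
      omega
  refine ⟨Function.update f n x, ⟨?_, ?_, ?_⟩, ?_⟩
  · intro i hi
    rcases Nat.lt_succ_iff_lt_or_eq.1 hi with hi | rfl
    · rw [hlt i hi]
      exact Or.inr (hmem i hi)
    · rw [heq]
      exact Or.inl rfl
  · intro i hi j hj e
    rcases Nat.lt_succ_iff_lt_or_eq.1 hi with hi | rfl <;>
      rcases Nat.lt_succ_iff_lt_or_eq.1 hj with hj | rfl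
    · rw [hlt i hi, hlt j hj] at e
      exact h.bij.injOn hi hj e
    · rw [hlt i hi, heq] at e
      exact absurd (e ▸ hmem i hi) hx
    · rw [hlt j hj, heq] at e
      exact absurd (e ▸ hmem j hj) hx
    · rfl
  · rintro z (rfl | hz)
    · exact ⟨n, Nat.lt_succ_self n, heq⟩
    · obtain ⟨i, hi, rfl⟩ := h.bij.surjOn hz
      have hi : i < n := hi
      exact ⟨i, Nat.lt_succ_of_lt hi, hlt i hi⟩
  · intro i hi j hj hij
    rcases Nat.lt_succ_iff_lt_or_eq.1 hi with hi | rfl <;>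
      rcases Nat.lt_succ_iff_lt_or_eq.1 hj with hj | rfl
    · rw [hlt i hi, hlt j hj]
      exact h.meet_iff i hi j hj hij
    · rw [hlt i hi, heq, Set.inter_comm, hmi i hi]
      omega
    · rw [hlt j hj, heq, hmi j hj]
      omega
    · exact absurd rfl hij

end PathEnum

lemma isPathGraph_iff {D : Set (LGraph α)} :
    IsPathGraph (decompTree D) ↔ ∃ n f, PathEnum D n f := by
  constructor
  · rintro ⟨n, ⟨φ⟩⟩
    classical
    by_cases hn : n = 0
    · subst hn
      have hD : D = ∅ := Set.eq_empty_of_forall_notMem fun x hx => (φ ⟨x, hx⟩).elim0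
      subst hD
      exact ⟨0, fun _ => ⊤, ⟨⟨fun i hi => absurd hi (Nat.not_lt_zero i),
        fun i hi => absurd hi (Nat.not_lt_zero i), fun x hx => absurd hx (Set.notMem_empty x)⟩,
        fun i hi => absurd hi (Nat.not_lt_zero i)⟩⟩
    · have h0 : 0 < n := Nat.pos_of_ne_zero hn
      let f : ℕ → LGraph α := fun i =>
        (φ.symm (if h : i < n then ⟨i, h⟩ else ⟨0, h0⟩) : D)
      have hf : ∀ i (hi : i < n), f i = (φ.symm ⟨i, hi⟩ : D) := fun i hi => by simp [f, hi]
      refine ⟨n, f, ⟨?_, ?_, ?_⟩, ?_⟩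
      · intro i hi
        rw [hf i hi]
        exact Subtype.coe_prop _
      · intro i hi j hj e
        rw [hf i hi, hf j hj] at e
        have := φ.symm.injective (Subtype.ext e)
        exact congrArg Fin.val this
      · intro x hx
        refine ⟨φ ⟨x, hx⟩, (φ ⟨x, hx⟩).2, ?_⟩
        rw [hf _ (φ ⟨x, hx⟩).2]
        simp
      · intro i hi j hj hij
        have := φ.symm.map_adj_iff (v := ⟨i, hi⟩) (w := ⟨j, hj⟩)
        rw [SimpleGraph.pathGraph_adj] at this
        rw [← this, hf i hi, hf j hj]
        refine ⟨fun h => ⟨?_, h⟩, fun h => h.2⟩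
        intro e
        have := φ.symm.injective e
        exact hij (congrArg Fin.val this)
  · rintro ⟨n, f, h⟩
    let e : Fin n → D := fun i => ⟨f i, h.bij.mapsTo i.2⟩
    have he : Function.Bijective e := by
      constructor
      · intro i j hij
        exact Fin.ext (h.bij.injOn i.2 j.2 (congrArg Subtype.val hij))
      · rintro ⟨x, hx⟩
        obtain ⟨i, hi, rfl⟩ := h.bij.surjOn hx
        exact ⟨⟨i, hi⟩, rfl⟩
    refine ⟨n, ⟨(RelIso.symm ⟨Equiv.ofBijective e he, ?_⟩)⟩⟩
    intro i j
    rw [SimpleGraph.pathGraph_adj]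
    change (e i ≠ e j ∧ ((f i).verts ∩ (f j).verts).Nonempty) ↔ _
    by_cases hij : i = j
    · subst hij
      simp
    · rw [h.meet_iff i i.2 j j.2 (fun h => hij (Fin.ext h))]
      exact and_iff_right fun e' => hij (he.1 e')

/-- A decomposition tree without three leaves is a path. -/
lemma Dec.pathEnum {K : LGraph α} {D : Set (LGraph α)} (h : Dec K D)
    (h3 : ∀ a b c a' b' c', IsLeafOf D a a' → IsLeafOf D b b' → IsLeafOf D c c' →
      a = b ∨ b = c ∨ a = c) : ∃ n f, PathEnum D n f := by
  obtain ⟨k, hk⟩ : ∃ k, D.ncard = k := ⟨_, rfl⟩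
  induction k using Nat.strong_induction_on generalizing K D with
  | _ k ih =>
  obtain ⟨N, hN⟩ := h.nonempty
  by_cases hD : D = {N}
  · subst hD
    refine ⟨1, fun _ => N, ⟨fun _ _ => rfl, fun i hi j hj _ => ?_, fun x hx => ⟨0, ?_, ?_⟩⟩, ?_⟩
    · simp only [Set.mem_Iio] at hi hj
      omega
    · simp
    · exact hx.symm
    · intro i hi j hj hij
      omega
  obtain ⟨x, y, hx, -⟩ := h.exists_leaf hN hD
  obtain ⟨m, hmx, hmy⟩ := hx.meet
  obtain ⟨K', -, h'⟩ := h.remove_leafOf hx hmx hmy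
  have hlt : (D \ {x}).ncard < k := hk ▸ Set.ncard_sdiff_singleton_lt_of_mem hx.mem h.finite
  -- removing the leaf `x` creates no new leaf, except possibly its neighbour
  have up : ∀ z z', IsLeafOf (D \ {x}) z z' → z ≠ y → IsLeafOf D z z' ∧ z ≠ x := by
    intro z z' hz hzy
    have hzx : z ≠ x := hz.mem.2
    refine ⟨⟨hz.mem.1, hz.mem'.1, hz.ne, hz.meet, fun w hw hwz hm => ?_⟩, hzx⟩
    by_cases hwx : w = x
    · subst hwx
      exact absurd (hx.unique z hz.mem.1 hzx (by rwa [Set.inter_comm])) hzy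
    · exact hz.unique w ⟨hw, hwx⟩ hwz hm
  -- a leaf other than `y` is a leaf of `D`, so two of them would make three together with `x`
  have two : ∀ a b a' b', IsLeafOf (D \ {x}) a a' → IsLeafOf (D \ {x}) b b' → a ≠ y → b ≠ y →
      a = b := by
    intro a b a' b' ha hb hay hby
    obtain ⟨ha, hax⟩ := up a a' ha hay
    obtain ⟨hb, hbx⟩ := up b b' hb hby
    rcases h3 _ _ _ _ _ _ ha hb hx with e | e | e
    · exact e
    · exact absurd e hbx
    · exact absurd e hax
  obtain ⟨n, f, hf⟩ := ih _ hlt h' (by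
    intro a b c a' b' c' ha hb hc
    by_cases hay : a = y
    · by_cases hby : b = y
      · exact Or.inl (hay.trans hby.symm)
      by_cases hcy : c = y
      · exact Or.inr (Or.inr (hay.trans hcy.symm))
      exact Or.inr (Or.inl (two _ _ _ _ hb hc hby hcy))
    by_cases hby : b = y
    · by_cases hcy : c = y
      · exact Or.inr (Or.inl (hby.trans hcy.symm))
      exact Or.inr (Or.inr (two _ _ _ _ ha hc hay hcy))
    exact Or.inl (two _ _ _ _ ha hb hay hby)) rfl
  have hyD : y ∈ D \ {x} := ⟨hx.mem', hx.ne.symm⟩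
  obtain ⟨i, hi, hiy⟩ := hf.bij.surjOn hyD
  have hi : i < n := hi
  have hext : ∀ g, PathEnum (D \ {x}) n g → y = g (n - 1) → ∃ n f, PathEnum D n f := by
    intro g hg hy
    obtain ⟨g', hg'⟩ := hg.extend (by omega) (x := x) (fun h => h.2 rfl) (by
      intro z hz
      rw [← hy]
      refine ⟨hx.unique z hz.1 hz.2, ?_⟩
      rintro rfl
      exact hx.meet)
    rw [Set.insert_sdiff_singleton, Set.insert_eq_of_mem hx.mem] at hg'
    exact ⟨_, _, hg'⟩
  by_cases h1 : i = n - 1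
  · exact hext f hf (by rw [← hiy, h1])
  by_cases h0 : i = 0
  · refine hext _ hf.reverse ?_
    rw [show n - 1 - (n - 1) = 0 by omega, ← hiy, h0]
  exfalso
  obtain ⟨y₀, hy₀⟩ := hf.leaf_first (by omega)
  refine hf.ne (i := 0) (j := n - 1) (by omega) (by omega) (by omega)
    (two _ _ _ _ hy₀ (hf.leaf_last (by omega)) ?_ ?_)
  · rw [← hiy]
    exact hf.ne (by omega) hi (by omega)
  · rw [← hiy]
    exact hf.ne (by omega) hi (by omega)

/-! ### Asteroidal triples from leaves that cannot be pruned -/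

/-- `K` is a star with centre `c`. -/
def IsStarAt (K : LGraph α) (c : α) : Prop :=
  c ∈ K.verts ∧ ∀ x ∈ K.verts, ∀ y ∈ K.verts, K.Adj x y ↔ x ≠ y ∧ (x = c ∨ y = c)

/-- No marker is the centre of a star on one side and a leaf of a star on the other. -/
def StarReduced (D : Set (LGraph α)) : Prop :=
  ∀ x ∈ D, ∀ y ∈ D, x ≠ y → ∀ m c, m ∈ x.verts → m ∈ y.verts → IsStarAt x m → IsStarAt y c → c = m

lemma IsStarAt.isUniversalIn {K : LGraph α} {c : α} (h : IsStarAt K c) : IsUniversalIn K c :=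
  ⟨h.1, fun w hw hwc => (h.2 c h.1 w hw).2 ⟨hwc.symm, Or.inl rfl⟩⟩

lemma IsCliqueGraph.isUniversalIn {K : LGraph α} {c : α} (h : IsCliqueGraph K) (hc : c ∈ K.verts) :
    IsUniversalIn K c :=
  ⟨hc, fun w hw hwc => h c hc w hw hwc.symm⟩

/-- A clique or a star remains connected after removal of a vertex that is not the centre. -/
lemma connOn_compl_of_clique_or_star {K : LGraph α} {m : α}
    (h : IsCliqueGraph K ∨ ∃ c, c ≠ m ∧ IsStarAt K c) : ConnOn K (K.verts \ {m}) := by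
  rcases h with h | ⟨c, hcm, hc, h⟩
  · rintro x hx y hy
    by_cases hxy : x = y
    · exact hxy ▸ .refl
    · exact .single ⟨h x hx.1 y hy.1 hxy, hx, hy⟩
  · refine ConnOn.of_reach (a := c) fun x hx => ?_
    by_cases hxc : x = c
    · exact hxc ▸ .refl
    · exact .single ⟨(h x hx.1 c hc).2 ⟨hxc, Or.inr rfl⟩, hx, hc, hcm⟩

/-- A leaf `x` that cannot be pruned is a star whose marker is not the centre. It contains a vertex
all of whose neighbours lie in `x`, and the remaining part of the graph is connected since the
marker is not the centre of a star in the neighbour of `x` in the tree either. -/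
lemma Dec.leaf_pendant {K : LGraph α} {D : Set (LGraph α)} (h : Dec K D) (hK : ConnOn K K.verts)
    (hcs : ∀ L ∈ D, IsCliqueGraph L ∨ IsStar L) (hred : StarReduced D) {x y : LGraph α}
    (hx : IsLeafOf D x y) (hnp : ∀ l ∈ y.verts, ¬ IsUniversalIn x l) :
    ∃ w ∈ x.verts, w ∈ K.verts ∧ (∀ z, K.Adj w z → z ∈ x.verts) ∧
      ConnOn K (K.verts \ x.verts) := by
  obtain ⟨m, hmx, hmy⟩ := hx.meet
  obtain ⟨K', hc, h'⟩ := h.remove_leafOf hx hmx hmy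
  have hnu := hnp m hmy
  rcases hcs x hx.mem with hcl | ⟨c, hst⟩
  · exact absurd (hcl.isUniversalIn hmx) hnu
  have hst : IsStarAt x c := hst
  have hcm : c ≠ m := by
    rintro rfl
    exact hnu hst.isUniversalIn
  obtain ⟨w, hw, hwm, hmw⟩ : ∃ w ∈ x.verts, w ≠ m ∧ ¬ x.Adj m w := by
    by_contra hno
    push Not at hno
    exact hnu ⟨hmx, hno⟩
  refine ⟨w, hw, hc.mem_left hw hwm, ?_, ?_⟩
  · intro z hz
    obtain ⟨hzm, hzx | hzK⟩ := (hc.mem_iff z).1 hz.snd_mem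
    · exact hzx
    · exact absurd ((hc.adj_cross hw hzK hwm hzm).1 hz).1.symm hmw
  · have hP : ConnOn y (y.verts \ {m}) := by
      apply connOn_compl_of_clique_or_star
      rcases hcs y hx.mem' with hcl | ⟨c', hst'⟩
      · exact Or.inl hcl
      · refine Or.inr ⟨c', ?_, hst'⟩
        rintro rfl
        exact hcm (hred y hx.mem' x hx.mem hx.ne.symm _ c hmy hmx hst' hst)
    have hK' := h'.connOn_compl (hc.symm.connOn_left hK) hc.right_mem ⟨hx.mem', hx.ne.symm⟩ hmy hP
    have e : K.verts \ x.verts = K'.verts \ {m} := by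
      ext z
      have := hc.inter z
      have := hc.left_mem
      have : z = m → z ∈ x.verts := fun e => e ▸ hmx
      simp only [Set.mem_sdiff, hc.mem_iff, Set.mem_singleton_iff]
      tauto
    rw [e]
    intro s hs t ht
    refine Relation.ReflTransGen.mono ?_ _ _ (hK' s hs t ht)
    rintro s t ⟨hst, hs, ht⟩
    exact ⟨(hc.symm.adj_left hs.1 ht.1 hs.2 ht.2).2 hst, hs, ht⟩

/-- Three leaves that cannot be pruned yield an asteroidal triple. -/
lemma Dec.hasAT_of_three_leaves {K : LGraph α} {D : Set (LGraph α)} (h : Dec K D)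
    (hK : ConnOn K K.verts) (hcs : ∀ L ∈ D, IsCliqueGraph L ∨ IsStar L) (hred : StarReduced D)
    (hnp : ∀ x y, IsLeafOf D x y → ∀ l ∈ y.verts, ¬ IsUniversalIn x l)
    {a b c a' b' c' : LGraph α} (ha : IsLeafOf D a a') (hb : IsLeafOf D b b')
    (hc : IsLeafOf D c c') (hab : a ≠ b) (hbc : b ≠ c) (hac : a ≠ c) : HasAT K := by
  obtain ⟨u, hu, huK, huN, huC⟩ := h.leaf_pendant hK hcs hred ha (hnp _ _ ha)
  obtain ⟨v, hv, hvK, hvN, hvC⟩ := h.leaf_pendant hK hcs hred hb (hnp _ _ hb)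
  obtain ⟨w, hw, hwK, hwN, hwC⟩ := h.leaf_pendant hK hcs hred hc (hnp _ _ hc)
  have out : ∀ {x y : LGraph α} {z : α}, x ∈ D → y ∈ D → x ≠ y → z ∈ x.verts → z ∈ K.verts →
      z ∈ K.verts \ y.verts := fun hx hy hne hzx hz =>
    ⟨hz, fun hzy => hne (h.eq_of_mem_verts hx hy hzx hzy hz)⟩
  have reach : ∀ {x : LGraph α} {u s t : α}, u ∈ x.verts → (∀ z, K.Adj u z → z ∈ x.verts) →
      ConnOn K (K.verts \ x.verts) → s ∈ K.verts \ x.verts → t ∈ K.verts \ x.verts →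
      FarReach K u s t := by
    intro x u s t hu hN hC hs ht
    refine Relation.ReflTransGen.mono ?_ _ _ (hC s hs t ht)
    rintro s t ⟨hst, hs, ht⟩
    exact ⟨hst, ⟨fun e => hs.2 (e ▸ hu), fun h => hs.2 (hN s h)⟩,
      fun e => ht.2 (e ▸ hu), fun h => ht.2 (hN t h)⟩
  refine ⟨u, v, w, ?_, ?_, ?_,
    reach hu huN huC (out hb.mem ha.mem hab.symm hv hvK) (out hc.mem ha.mem hac.symm hw hwK),
    reach hv hvN hvC (out ha.mem hb.mem hab hu huK) (out hc.mem hb.mem hbc.symm hw hwK),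
    reach hw hwN hwC (out ha.mem hc.mem hac hu huK) (out hb.mem hc.mem hbc hv hvK)⟩
  · rintro rfl
    exact hab (h.eq_of_mem_verts ha.mem hb.mem hu hv huK)
  · rintro rfl
    exact hbc (h.eq_of_mem_verts hb.mem hc.mem hv hw hvK)
  · rintro rfl
    exact hac (h.eq_of_mem_verts ha.mem hc.mem hu hw huK)

/-! ### Permutation models -/

/-- Two linear orders on the vertices of `K`, given by injective labellings `f` and `g`, such that
adjacency means that the orders disagree. -/
structure PermModel (K : LGraph α) {X Y : Type*} [LinearOrder X] [LinearOrder Y] (f : α → X)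
    (g : α → Y) : Prop where
  inj_left : Set.InjOn f K.verts
  inj_right : Set.InjOn g K.verts
  adj_iff : ∀ x ∈ K.verts, ∀ y ∈ K.verts, f x < f y → (K.Adj x y ↔ g y < g x)

/-- `K` is a permutation graph. -/
def IsPerm (K : LGraph α) : Prop :=
  ∃ (X Y : Type) (_ : LinearOrder X) (_ : LinearOrder Y) (f : α → X) (g : α → Y), PermModel K f g

/-- `K` is a permutation graph, with a model in which `m` is last in the first order. -/
def IsPermLast (K : LGraph α) (m : α) : Prop :=
  ∃ (X Y : Type) (_ : LinearOrder X) (_ : LinearOrder Y) (f : α → X) (g : α → Y), PermModel K f g ∧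
    ∀ z ∈ K.verts, z ≠ m → f z < f m

lemma IsPermLast.isPerm {K : LGraph α} {m : α} (h : IsPermLast K m) : IsPerm K := by
  obtain ⟨X, Y, iX, iY, f, g, h, -⟩ := h
  exact ⟨X, Y, iX, iY, f, g, h⟩

section

variable {X Y : Type*} [LinearOrder X] [LinearOrder Y] {K : LGraph α} {f : α → X} {g : α → Y}

lemma PermModel.swap (h : PermModel K f g) : PermModel K g f where
  inj_left := h.inj_right
  inj_right := h.inj_left
  adj_iff := by
    intro x hx y hy hxy
    rcases lt_trichotomy (f x) (f y) with hf | hf | hf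
    · rw [h.adj_iff x hx y hy hf]
      exact ⟨fun h' => absurd h' hxy.asymm, fun h' => absurd h' hf.asymm⟩
    · rw [h.inj_left hx hy hf] at hxy
      exact absurd hxy (lt_irrefl _)
    · rw [K.adj_comm, h.adj_iff y hy x hx hf]
      exact ⟨fun _ => hf, fun _ => hxy⟩

/-- Adjacency expressed without the assumption that one vertex comes first in the first order. -/
lemma PermModel.adj_iff_or (h : PermModel K f g) {x y : α} (hx : x ∈ K.verts) (hy : y ∈ K.verts) :
    K.Adj x y ↔ (f x < f y ∧ g y < g x) ∨ (f y < f x ∧ g x < g y) := by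
  rcases lt_trichotomy (f x) (f y) with hf | hf | hf
  · rw [h.adj_iff x hx y hy hf]
    have := hf.asymm
    tauto
  · have := h.inj_left hx hy hf
    subst this
    exact iff_of_false (fun h => h.ne rfl) (by simp)
  · rw [K.adj_comm, h.adj_iff y hy x hx hf]
    have := hf.asymm
    tauto

end

/-- Substituting a clique or an independent set for a vertex `m` of a permutation graph yields a
permutation graph. -/
lemma IsComp.isPerm_of_universal [Countable α] {K x K' : LGraph α} {m : α} (h : IsComp K x K' m)
    (hcs : IsCliqueGraph x ∨ IsStar x) (hm : IsUniversalIn x m) (hK' : IsPerm K') : IsPerm K := by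
  classical
  obtain ⟨e, he⟩ := exists_injective_nat α
  -- a model of `x - m`
  obtain ⟨q, hqi, hq⟩ : ∃ q : α → ℤ, Function.Injective q ∧ ∀ s ∈ x.verts, ∀ t ∈ x.verts, s ≠ m →
      t ≠ m → e s < e t → (x.Adj s t ↔ q t < q s) := by
    have hclique : IsCliqueGraph x → ∃ q : α → ℤ, Function.Injective q ∧ ∀ s ∈ x.verts,
        ∀ t ∈ x.verts, s ≠ m → t ≠ m → e s < e t → (x.Adj s t ↔ q t < q s) := by
      intro hcl
      refine ⟨fun z => -(e z : ℤ), fun a b hab => he (by simpa using hab), ?_⟩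
      intro s hs t ht _ _ hst
      refine ⟨fun _ => by simpa using hst, fun _ => hcl s hs t ht ?_⟩
      rintro rfl
      exact lt_irrefl _ hst
    rcases hcs with hcl | ⟨c, hc, hst⟩
    · exact hclique hcl
    · have hcm : c = m := by
        -- otherwise `c` would be the only vertex besides `m`
        by_contra hcm
        obtain ⟨z, hz, hzc⟩ := h.nontrivial_left.exists_ne c
        have := ((hst m h.left_mem z hz.1).1 (hm.2 z hz.1 hz.2)).2
        rcases this with e | e
        · exact hcm e.symm
        · exact hzc e
      subst hcm
      refine ⟨fun z => (e z : ℤ), fun a b hab => he (by simpa using hab), ?_⟩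
      intro s hs t ht hsm htm hlt
      have h₁ : ¬ x.Adj s t := fun h => by
        rcases ((hst s hs t ht).1 h).2 with e | e
        · exact hsm e
        · exact htm e
      have h₂ : ¬ ((e t : ℤ) < e s) := by
        have : (e s : ℤ) < e t := by exact_mod_cast hlt
        exact this.asymm
      exact iff_of_false h₁ h₂
  obtain ⟨X, Y, iX, iY, f, g, hfg⟩ := hK'
  let F : α → X ×ₗ ℕ := fun z => toLex (if z ∈ x.verts then f m else f z, e z)
  let G : α → Y ×ₗ ℤ := fun z => toLex (if z ∈ x.verts then g m else g z, q z)
  have hx' : ∀ z ∈ K.verts, z ∉ x.verts → z ∈ K'.verts := fun z hz hzx =>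
    ((h.mem_iff z).1 hz).2.resolve_left hzx
  have hne : ∀ z ∈ K.verts, z ≠ m := fun z hz => ((h.mem_iff z).1 hz).1
  refine ⟨_, _, inferInstance, inferInstance, F, G, ?_, ?_, ?_⟩
  · intro a _ b _ hab
    exact he (congrArg (fun p => (ofLex p).2) hab)
  · intro a _ b _ hab
    exact hqi (congrArg (fun p => (ofLex p).2) hab)
  · intro a ha b hb hab
    have ham := hne a ha
    have hbm := hne b hb
    by_cases hax : a ∈ x.verts <;> by_cases hbx : b ∈ x.verts <;>
      simp only [F, G, hax, hbx, if_true, if_false, Prod.Lex.toLex_lt_toLex] at hab ⊢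
    · rw [h.adj_left hax hbx ham hbm, hq a hax b hbx ham hbm (by simpa using hab)]
      simp
    · have hbK := hx' b hb hbx
      have hfne : f m ≠ f b := fun e => hbm (hfg.inj_left h.right_mem hbK e).symm
      have hgne : g b ≠ g m := fun e => hbm (hfg.inj_right h.right_mem hbK e.symm).symm
      rw [h.adj_cross hax hbK ham hbm, hfg.adj_iff m h.right_mem b hbK
        (hab.resolve_right fun h => hfne h.1)]
      have := (hm.2 a hax ham).symm
      tauto
    · have haK := hx' a ha hax
      have hfne : f a ≠ f m := fun e => ham (hfg.inj_left haK h.right_mem e)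
      have hgne : g m ≠ g a := fun e => ham (hfg.inj_right haK h.right_mem e.symm)
      rw [h.symm.adj_cross haK hbx ham hbm, hfg.adj_iff a haK m h.right_mem
        (hab.resolve_right fun h => hfne h.1)]
      have := hm.2 b hbx hbm
      tauto
    · have haK := hx' a ha hax
      have hbK := hx' b hb hbx
      have hab' : a ≠ b := by
        rintro rfl
        simp at hab
      have hfne : f a ≠ f b := fun e => hab' (hfg.inj_left haK hbK e)
      have hgne : g b ≠ g a := fun e => hab' (hfg.inj_right haK hbK e.symm)
      rw [h.symm.adj_left haK hbK ham hbm, hfg.adj_iff a haK b hbK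
        (hab.resolve_right fun h => hfne h.1)]
      tauto

/-- Composition of permutation models at a marker `v` that is last in the first order of one model
and first in the first order of the other. If the orders are `A, v` and `B, v, C` on one side and
`v, A'` and `B', v, C'` on the other, then the orders of the composition are `A, A'` and
`B, B', C, C'`. -/
lemma IsComp.isPermLast {K K₁ K₂ : LGraph α} {v m : α} (h : IsComp K K₁ K₂ v)
    (h₁ : IsPermLast K₁ v) {P Q : Type} [LinearOrder P] [LinearOrder Q] {p : α → P} {q : α → Q}
    (h₂ : PermModel K₂ p q) (hv : ∀ z ∈ K₂.verts, z ≠ v → p v < p z) (hm : m ∈ K₂.verts)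
    (hmv : m ≠ v) (hlast : (∀ z ∈ K₂.verts, z ≠ m → p z < p m) ∨
      (∀ z ∈ K₂.verts, z ≠ m → q z < q m)) : IsPermLast K m := by
  classical
  obtain ⟨X, Y, iX, iY, f, g, hfg, hfv⟩ := h₁
  let F : α → X ⊕ₗ P := fun z => if z ∈ K₁.verts then Sum.inlₗ (f z) else Sum.inrₗ (p z)
  let G : α → ℕ ×ₗ (Y ⊕ₗ Q) := fun z =>
    if z ∈ K₁.verts then toLex (if g z < g v then 0 else 2, Sum.inlₗ (g z))
    else toLex (if q z < q v then 1 else 3, Sum.inrₗ (q z))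
  have hx' : ∀ z ∈ K.verts, z ∉ K₁.verts → z ∈ K₂.verts := fun z hz hzx =>
    ((h.mem_iff z).1 hz).2.resolve_left hzx
  have hne : ∀ z ∈ K.verts, z ≠ v := fun z hz => ((h.mem_iff z).1 hz).1
  have hm₁ : m ∉ K₁.verts := fun h' => hmv (h.inter m h' hm)
  have hcross : ∀ s ∈ K₁.verts, ∀ t ∈ K₂.verts, s ≠ v → t ≠ v →
      (K.Adj s t ↔ g v < g s ∧ q t < q v) := by
    intro s hs t ht hsv htv
    rw [h.adj_cross hs ht hsv htv, hfg.adj_iff s hs v h.left_mem (hfv s hs hsv),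
      h₂.adj_iff v h.right_mem t ht (hv t ht htv)]
  have model : PermModel K F G := by
    refine ⟨?_, ?_, ?_⟩
    · intro a ha b hb hab
      by_cases hax : a ∈ K₁.verts <;> by_cases hbx : b ∈ K₁.verts <;>
        simp only [F, hax, hbx, if_true, if_false] at hab
      · exact hfg.inj_left hax hbx (Sum.inl_injective hab)
      · exact absurd hab (by simp [Sum.inlₗ, Sum.inrₗ])
      · exact absurd hab (by simp [Sum.inlₗ, Sum.inrₗ])
      · exact h₂.inj_left (hx' a ha hax) (hx' b hb hbx) (Sum.inr_injective hab)
    · intro a ha b hb hab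
      by_cases hax : a ∈ K₁.verts <;> by_cases hbx : b ∈ K₁.verts <;>
        simp only [G, hax, hbx, if_true, if_false] at hab <;>
        replace hab := congrArg (fun p => (ofLex p).2) hab
      · exact hfg.inj_right hax hbx (Sum.inl_injective hab)
      · exact absurd hab (by simp [Sum.inlₗ, Sum.inrₗ])
      · exact absurd hab (by simp [Sum.inlₗ, Sum.inrₗ])
      · exact h₂.inj_right (hx' a ha hax) (hx' b hb hbx) (Sum.inr_injective hab)
    · intro a ha b hb hab
      have hav := hne a ha
      have hbv := hne b hb
      by_cases hax : a ∈ K₁.verts <;> by_cases hbx : b ∈ K₁.verts <;>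
        simp only [F, G, hax, hbx, if_true, if_false, Prod.Lex.toLex_lt_toLex,
          Sum.Lex.inl_lt_inl_iff, Sum.Lex.inr_lt_inr_iff, Sum.Lex.inl_lt_inr,
          Sum.Lex.not_inr_lt_inl] at hab ⊢
      · rw [h.adj_left hax hbx hav hbv, hfg.adj_iff a hax b hbx hab]
        split_ifs with h1 h2 h2
        · simp
        · simp only [Nat.reduceLT, true_or, iff_true]
          exact h1.trans_le (not_lt.1 h2)
        · simp only [Nat.reduceLT, false_and, or_false, iff_false, not_lt]
          exact h2.le.trans (not_lt.1 h1)
        · simp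
      · have hbK := hx' b hb hbx
        rw [hcross a hax b hbK hav hbv]
        have hga : g v ≠ g a := fun e => hav (hfg.inj_right hax h.left_mem e.symm)
        have hlt : g v < g a ↔ ¬ g a < g v :=
          ⟨fun h => h.asymm, fun h => lt_of_le_of_ne (not_lt.1 h) hga⟩
        rw [hlt]
        split_ifs <;> simp_all
      · have haK := hx' a ha hax
        have hbK := hx' b hb hbx
        rw [h.symm.adj_left haK hbK hav hbv, h₂.adj_iff a haK b hbK hab]
        split_ifs with h1 h2 h2
        · simp
        · simp only [Nat.reduceLT, true_or, iff_true]
          exact h1.trans_le (not_lt.1 h2)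
        · simp only [Nat.reduceLT, Nat.reduceEqDiff, false_and, or_false, iff_false, not_lt]
          exact h2.le.trans (not_lt.1 h1)
        · simp
  rcases hlast with hl | hl
  · refine ⟨_, _, inferInstance, inferInstance, F, G, model, fun z hz hzm => ?_⟩
    by_cases hzx : z ∈ K₁.verts <;>
      simp only [F, hzx, hm₁, if_true, if_false, Sum.Lex.inl_lt_inr, Sum.Lex.inr_lt_inr_iff]
    exact hl z (hx' z hz hzx) hzm
  · have hqm : ¬ q m < q v := (hl v h.right_mem hmv.symm).asymm
    refine ⟨_, _, inferInstance, inferInstance, G, F, model.swap, fun z hz hzm => ?_⟩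
    by_cases hzx : z ∈ K₁.verts <;>
      simp only [G, hzx, hm₁, hqm, if_true, if_false, Prod.Lex.toLex_lt_toLex,
        Sum.Lex.inr_lt_inr_iff]
    · left
      split_ifs <;> omega
    · have := hl z (hx' z hz hzx) hzm
      split_ifs <;> simp [this]

/-- Permutation models of cliques and stars with a prescribed first vertex `a` and a prescribed
vertex `m` that is last in one of the two orders. The orders sort by priority and then by an
injective numbering; for a star they differ in the position of the centre, which is at opposite
ends. -/
lemma exists_permModel [Countable α] {K : LGraph α} (hcs : IsCliqueGraph K ∨ IsStar K) {a m : α}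
    (ham : a ≠ m) : ∃ (P Q : Type) (_ : LinearOrder P) (_ : LinearOrder Q) (p : α → P) (q : α → Q),
      PermModel K p q ∧ (∀ z ∈ K.verts, z ≠ a → p a < p z) ∧
      ((∀ z ∈ K.verts, z ≠ m → p z < p m) ∨ (∀ z ∈ K.verts, z ≠ m → q z < q m)) := by
  classical
  obtain ⟨e, he⟩ := exists_injective_nat α
  have inj : ∀ r : α → ℕ, Function.Injective (fun z => (toLex (r z, e z) : ℕ ×ₗ ℕ)) :=
    fun r s t hst => he (congrArg (fun p => (ofLex p).2) hst)
  let r : α → ℕ := fun z => if z = a then 1 else if z = m then 3 else 2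
  have ra : r a = 1 := by simp [r]
  have rm : r m = 3 := by simp [r, ham.symm]
  have r1 : ∀ z, 1 ≤ r z ∧ r z ≤ 3 := by
    intro z
    simp only [r]
    split_ifs <;> simp
  have r2 : ∀ z, z ≠ a → 1 < r z := by
    intro z hz
    simp only [r, hz, if_false]
    split_ifs <;> simp
  have r3 : ∀ z, z ≠ m → r z < 3 := by
    intro z hz
    simp only [r, hz, if_false]
    split_ifs <;> simp
  let up : α → α → ℕ := fun c z => if z = c then 4 else r z
  let dn : α → α → ℕ := fun c z => if z = c then 0 else r z
  rcases hcs with hcl | ⟨c, hc, hst⟩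
  · refine ⟨ℕ ×ₗ ℕ, (ℕ ×ₗ ℕ)ᵒᵈ, inferInstance, inferInstance, fun z => toLex (r z, e z),
      fun z => OrderDual.toDual (toLex (r z, e z)), ⟨(inj r).injOn, ?_, ?_⟩, ?_, ?_⟩
    · exact (OrderDual.toDual.injective.comp (inj r)).injOn
    · intro x hx y hy hxy
      refine ⟨fun _ => hxy, fun _ => hcl x hx y hy ?_⟩
      rintro rfl
      exact lt_irrefl _ hxy
    · intro z _ hz
      exact Prod.Lex.toLex_lt_toLex.2 (Or.inl (by simpa [ra] using r2 z hz))
    · left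
      intro z _ hz
      exact Prod.Lex.toLex_lt_toLex.2 (Or.inl (by simpa [rm] using r3 z hz))
  · have model : PermModel K (fun z => (toLex (up c z, e z) : ℕ ×ₗ ℕ))
        (fun z => (toLex (dn c z, e z) : ℕ ×ₗ ℕ)) := by
      refine ⟨(inj _).injOn, (inj _).injOn, ?_⟩
      intro x hx y hy hxy
      have hne : x ≠ y := by
        rintro rfl
        exact lt_irrefl _ hxy
      rw [hst x hx y hy, Prod.Lex.toLex_lt_toLex]
      rw [Prod.Lex.toLex_lt_toLex] at hxy
      have := r1 x
      have := r1 y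
      simp only [up, dn] at hxy ⊢
      by_cases hxc : x = c
      · subst hxc
        simp only [hne.symm, if_true, if_false] at hxy ⊢
        omega
      · by_cases hyc : y = c
        · subst hyc
          simp only [hne, if_true, if_false, or_true] at hxy ⊢
          exact iff_of_true ⟨hne, trivial⟩ (Or.inl (by omega))
        · simp only [hxc, hyc, if_false] at hxy ⊢
          refine iff_of_false (fun h => by simp at h) ?_
          omega
    have upm : ∀ z, z ≠ m → c ≠ m → (toLex (dn c z, e z) : ℕ ×ₗ ℕ) < toLex (dn c m, e m) := by
      intro z hz hcm
      have := r3 z hz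
      refine Prod.Lex.toLex_lt_toLex.2 (Or.inl ?_)
      simp only [dn, hcm.symm, if_false, rm]
      split_ifs <;> omega
    by_cases hca : c = a
    · subst hca
      refine ⟨_, _, inferInstance, inferInstance, _, _, model.swap, ?_, Or.inl fun z _ hz =>
        upm z hz ham⟩
      intro z _ hz
      have := r2 z hz
      refine Prod.Lex.toLex_lt_toLex.2 (Or.inl ?_)
      simp only [dn, hz, if_true, if_false]
      omega
    · refine ⟨_, _, inferInstance, inferInstance, _, _, model, ?_, ?_⟩
      · intro z _ hz
        have := r2 z hz
        refine Prod.Lex.toLex_lt_toLex.2 (Or.inl ?_)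
        simp only [up, ra, (Ne.symm hca : a ≠ c), if_false]
        split_ifs <;> omega
      · by_cases hcm : c = m
        · subst hcm
          left
          intro z _ hz
          have := r1 z
          refine Prod.Lex.toLex_lt_toLex.2 (Or.inl ?_)
          simp only [up, hz, if_true, if_false]
          omega
        · exact Or.inr fun z _ hz => upm z hz hcm

lemma isPermLast_of_clique_or_star [Countable α] {K : LGraph α}
    (hcs : IsCliqueGraph K ∨ IsStar K) (m : α) : IsPermLast K m := by
  by_cases hK : ∃ a ∈ K.verts, a ≠ m
  · obtain ⟨a, -, ham⟩ := hK
    obtain ⟨P, Q, iP, iQ, p, q, h, -, hl | hl⟩ := exists_permModel hcs ham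
    · exact ⟨P, Q, iP, iQ, p, q, h, hl⟩
    · exact ⟨Q, P, iQ, iP, q, p, h.swap, hl⟩
  · push Not at hK
    refine ⟨ℕ, ℕ, inferInstance, inferInstance, fun _ => 0, fun _ => 0, ⟨?_, ?_, ?_⟩, ?_⟩
    · intro x hx y hy _
      rw [hK x hx, hK y hy]
    · intro x hx y hy _
      rw [hK x hx, hK y hy]
    · intro x _ y _ h
      exact absurd h (lt_irrefl _)
    · intro z hz hzm
      exact absurd (hK z hz) hzm

lemma PathEnum.remove_last {D : Set (LGraph α)} {n : ℕ} {f : ℕ → LGraph α}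
    (h : PathEnum D (n + 1) f) : PathEnum (D \ {f n}) n f where
  bij := by
    refine ⟨fun i hi => ?_, h.bij.injOn.mono fun i hi => Nat.lt_succ_of_lt hi, ?_⟩
    · have hi : i < n := hi
      exact ⟨h.bij.mapsTo (Nat.lt_succ_of_lt hi), h.ne (by omega) (by omega) (by omega)⟩
    · rintro x ⟨hx, hxn⟩
      obtain ⟨i, hi, rfl⟩ := h.bij.surjOn hx
      have hi : i < n + 1 := hi
      refine ⟨i, ?_, rfl⟩
      have : i ≠ n := by
        rintro rfl
        exact hxn rfl
      change i < n
      omega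
  meet_iff := fun i hi j hj => h.meet_iff i (by omega) j (by omega)

/-- Along a path of cliques and stars a permutation model is built from one end, every vertex of
the graph at the other end being available as the last vertex of the first order. -/
lemma Dec.isPermLast [Countable α] {K : LGraph α} {D : Set (LGraph α)} (h : Dec K D)
    (hcs : ∀ L ∈ D, IsCliqueGraph L ∨ IsStar L) {n : ℕ} {f : ℕ → LGraph α}
    (hf : PathEnum D (n + 1) f) {m : α} (hm : m ∈ K.verts) (hmf : m ∈ (f n).verts) :
    IsPermLast K m := by
  induction n generalizing K D m with
  | zero =>
    have hD : D = {f 0} := by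
      ext x
      constructor
      · intro hx
        obtain ⟨i, hi, rfl⟩ := hf.bij.surjOn hx
        have hi : i < 0 + 1 := hi
        rw [show i = 0 by omega]
        rfl
      · rintro rfl
        exact hf.bij.mapsTo (show 0 < 0 + 1 by omega)
    obtain rfl := h.eq_of_singleton hD
    exact isPermLast_of_clique_or_star (hcs _ (hD ▸ rfl)) m
  | succ n ih =>
    have hleaf : IsLeafOf D (f (n + 1)) (f n) := hf.leaf_last (by omega)
    obtain ⟨v, hvx, hvy⟩ := hleaf.meet
    obtain ⟨K', hc, h'⟩ := h.remove_leafOf hleaf hvx hvy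
    have hmv : m ≠ v := fun e => hc.notMem (e ▸ hm)
    have hK' := ih h' (fun L hL => hcs L hL.1) hf.remove_last hc.right_mem hvy
    obtain ⟨P, Q, iP, iQ, p, q, hpq, hfirst, hlast⟩ :=
      exists_permModel (hcs _ hleaf.mem) hmv.symm
    exact hc.symm.isPermLast hK' hpq hfirst hmf hmv hlast

lemma Dec.isPerm_of_path [Countable α] {K : LGraph α} {D : Set (LGraph α)} (h : Dec K D)
    (hK : K.verts.Nonempty) (hcs : ∀ L ∈ D, IsCliqueGraph L ∨ IsStar L) {n : ℕ}
    {f : ℕ → LGraph α} (hf : PathEnum D n f) : IsPerm K := by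
  obtain ⟨N, hN⟩ := h.nonempty
  obtain ⟨i, hi, -⟩ := hf.bij.surjOn hN
  obtain _ | n := n
  · exact absurd hi (Nat.not_lt_zero i)
  obtain ⟨m, hm, hmf⟩ : ∃ m ∈ K.verts, m ∈ (f n).verts := by
    obtain _ | n := n
    · obtain ⟨m, hm⟩ := hK
      obtain ⟨L, hL, hmL⟩ := h.exists_mem_verts hm
      obtain ⟨i, hi, rfl⟩ := hf.bij.surjOn hL
      have hi : i < 0 + 1 := hi
      rw [show i = 0 by omega] at hmL
      exact ⟨m, hm, hmL⟩
    · have hleaf : IsLeafOf D (f (n + 1)) (f n) := hf.leaf_last (by omega)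
      obtain ⟨v, hvx, hvy⟩ := hleaf.meet
      obtain ⟨K', hc, -⟩ := h.remove_leafOf hleaf hvx hvy
      obtain ⟨m, hm, hmv⟩ := hc.nontrivial_left.nonempty
      exact ⟨m, hc.mem_left hm hmv, hm⟩
  exact (h.isPermLast hcs hf hm hmf).isPerm

section Graph

variable {V : Type*} {G : SimpleGraph V}

lemma isPermutationGraph_of_isPerm [Finite V] (h : IsPerm (toLGraph G)) : IsPermutationGraph G := by
  classical
  have := Fintype.ofFinite V
  obtain ⟨X, Y, iX, iY, f, g, h⟩ := h
  have rank : ∀ {Z : Type} [LinearOrder Z] (f : V ⊕ ℕ → Z), Set.InjOn f (toLGraph G).verts →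
      ∃ e : V ≃ Fin (Fintype.card V), ∀ u v, f (Sum.inl u) < f (Sum.inl v) ↔ e u < e v := by
    intro Z _ f hf
    let _ : LinearOrder V := LinearOrder.lift' (fun v => f (Sum.inl v)) fun u v huv =>
      Sum.inl_injective (hf (mem_toLGraph u) (mem_toLGraph v) huv)
    let e := Fintype.orderIsoFinOfCardEq V rfl
    exact ⟨e.symm.toEquiv, fun u v => (e.symm.lt_iff_lt (x := u) (y := v)).symm⟩
  obtain ⟨e, he⟩ := rank f h.inj_left
  obtain ⟨e', he'⟩ := rank g h.inj_right
  refine ⟨_, e, (e.symm.trans e').symm, fun u v => ?_⟩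
  rw [← toLGraph_adj, h.adj_iff_or (mem_toLGraph u) (mem_toLGraph v), he, he, he', he',
    mul_neg_iff]
  simp only [Equiv.symm_symm, Equiv.trans_apply, Equiv.symm_apply_apply, Fin.lt_def]
  omega

/-- If `b` lies between `a` and `c` in both orders, then a path from `a` to `c` contains a vertex
of `N[b]`. -/
lemma IsPermutationGraph.isATFree (h : IsPermutationGraph G) : IsATFree G := by
  classical
  obtain ⟨n, e, π, h⟩ := h
  rintro ⟨A, hA, hAT⟩
  -- `b` comes before `z` in both orders
  let R : V → V → Prop := fun b z => e b < e z ∧ π.symm (e b) < π.symm (e z)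
  have far : ∀ b z, z ≠ b → ¬ G.Adj b z → R b z ∨ R z b := by
    intro b z hzb hadj
    rw [h, mul_neg_iff] at hadj
    have h₁ : (e z : ℕ) ≠ e b := fun hh => hzb (e.injective (Fin.ext hh))
    have h₂ : (π.symm (e z) : ℕ) ≠ π.symm (e b) := fun hh =>
      hzb (e.injective (π.symm.injective (Fin.ext hh)))
    simp only [R, Fin.lt_def]
    omega
  have step : ∀ b s t, R s b → G.Adj s t → t ≠ b → ¬ G.Adj b t → R t b := by
    intro b s t hs hst htb hbt
    rcases far b t htb hbt with ht | ht
    · rw [h, mul_neg_iff] at hst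
      simp only [R, Fin.lt_def] at hs ht
      omega
    · exact ht
  have walk : ∀ b (x y : V) (p : G.Walk x y), (∀ z ∈ p.support, z ≠ b ∧ ¬ G.Adj b z) → R x b →
      R y b := by
    intro b x y p hp hx
    induction p with
    | nil => exact hx
    | @cons u v w hadj p ih =>
      have hp' : ∀ z ∈ p.support, z ≠ b ∧ ¬ G.Adj b z := fun z hz =>
        hp z (by simp [hz])
      have hv := hp' v p.start_mem_support
      exact ih hp' (step b u v hx hadj hv.1 hv.2)
  have between : ∀ a ∈ A, ∀ b ∈ A, ∀ c ∈ A, R a b → R b c → False := by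
    intro a ha b hb c hc hab hbc
    have hne : a ≠ b := by
      rintro rfl
      exact lt_irrefl _ hab.1
    have hne' : c ≠ b := by
      rintro rfl
      exact lt_irrefl _ hbc.1
    obtain ⟨p, -, hp⟩ := hAT b hb a ha c hc hne hne'
    exact lt_asymm (walk b a c p hp hab).1 hbc.1
  have tot : ∀ a ∈ A, ∀ b ∈ A, b ≠ a → R a b ∨ R b a := by
    intro a ha b hb hne
    obtain ⟨p, -, hp⟩ := hAT a ha b hb b hb hne hne
    have := hp b p.start_mem_support
    exact far a b this.1 this.2
  obtain ⟨a, b, c, hab, hac, hbc, rfl⟩ := Finset.card_eq_three.1 hA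
  have ha : a ∈ ({a, b, c} : Finset V) := by simp
  have hb : b ∈ ({a, b, c} : Finset V) := by simp
  have hc : c ∈ ({a, b, c} : Finset V) := by simp
  rcases tot a ha b hb hab.symm with h₁ | h₁ <;> rcases tot b hb c hc hbc.symm with h₂ | h₂ <;>
    rcases tot a ha c hc hac.symm with h₃ | h₃
  · exact between a ha b hb c hc h₁ h₂
  · exact between a ha b hb c hc h₁ h₂
  · exact between a ha c hc b hb h₃ h₂
  · exact between c hc a ha b hb h₃ h₁
  · exact between b hb a ha c hc h₁ h₃
  · exact between b hb c hc a ha h₂ h₃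
  · exact between c hc b hb a ha h₂ h₁
  · exact between c hc b hb a ha h₂ h₁

end Graph

/-! ### Existence of standard split decompositions -/

lemma SplitStep.ncard {D D' : Set (LGraph α)} (h : SplitStep D D') (hD : D.Finite) :
    D'.Finite ∧ D'.ncard = D.ncard + 1 := by
  obtain ⟨L, hL, v, L₁, L₂, hv, ⟨-, V₁, V₂, hs, rfl, rfl⟩, rfl⟩ := h
  have hf : (D \ {L}).Finite := hD.subset Set.sdiff_subset
  refine ⟨hf.union (Set.toFinite _), ?_⟩
  have h₁ : withMarker L V₁ V₂ v ∉ D := fun h => hv _ h (Or.inl rfl)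
  have h₂ : withMarker L V₂ V₁ v ∉ D := fun h => hv _ h (Or.inl rfl)
  have hne : withMarker L V₁ V₂ v ≠ withMarker L V₂ V₁ v := by
    intro e
    obtain ⟨z, hz⟩ := hs.nontrivial_left.nonempty
    have hz' : z ∈ (withMarker L V₂ V₁ v).verts := e ▸ Or.inr hz
    rcases hz' with rfl | hz'
    · exact hv L hL (hs.union_eq ▸ Or.inl hz)
    · exact Set.disjoint_left.1 hs.disjoint hz hz'
  rw [Set.ncard_union_eq ?_ hf (Set.toFinite _), Set.ncard_pair hne]
  · have := Set.ncard_sdiff_singleton_add_one hL hD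
    omega
  · rw [Set.disjoint_right]
    rintro X (rfl | rfl) hX
    · exact h₁ hX.1
    · exact h₂ hX.1

lemma IsComp.finite_left {K K₁ K₂ : LGraph α} {v : α} (h : IsComp K K₁ K₂ v)
    (hK : K.verts.Finite) : K₁.verts.Finite := by
  refine (hK.insert v).subset fun z hz => ?_
  by_cases hzv : z = v
  · exact Or.inl hzv
  · exact Or.inr (h.mem_left hz hzv)

lemma Dec.finite_labels {K : LGraph α} {D : Set (LGraph α)} (h : Dec K D) (hK : K.verts.Finite) :
    (labels D).Finite := by
  induction h with
  | single K => rwa [labels_singleton]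
  | node h _ _ _ ih₁ ih₂ =>
    rw [labels_union]
    exact (ih₁ (h.finite_left hK)).union (ih₂ (h.symm.finite_left hK))

lemma IsComp.ncard {K K₁ K₂ : LGraph α} {v : α} (h : IsComp K K₁ K₂ v) (hK : K.verts.Finite) :
    K₁.verts.ncard + K₂.verts.ncard = K.verts.ncard + 2 ∧ 3 ≤ K₁.verts.ncard := by
  have f₁ := h.finite_left hK
  have f₂ := h.symm.finite_left hK
  have e : K.verts = (K₁.verts \ {v}) ∪ (K₂.verts \ {v}) := by
    ext z
    rw [h.mem_iff]
    simp only [Set.mem_union, Set.mem_sdiff, Set.mem_singleton_iff]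
    tauto
  have hd : Disjoint (K₁.verts \ {v}) (K₂.verts \ {v}) := by
    rw [Set.disjoint_left]
    rintro z ⟨hz, hzv⟩ ⟨hz', -⟩
    exact hzv (h.inter z hz hz')
  have g₁ : (K₁.verts \ {v}).Finite := f₁.subset Set.sdiff_subset
  have hu := Set.ncard_union_eq hd g₁ (f₂.subset Set.sdiff_subset)
  have c₁ := Set.ncard_sdiff_singleton_add_one h.left_mem f₁
  have c₂ := Set.ncard_sdiff_singleton_add_one h.right_mem f₂
  have := g₁.to_subtype
  have c₃ := Set.one_lt_ncard_iff_nontrivial.2 h.nontrivial_left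
  rw [← e] at hu
  omega

/-- A decomposition of a graph with `n ≥ 3` vertices has at most `n - 2` graphs. -/
lemma Dec.ncard_le {K : LGraph α} {D : Set (LGraph α)} (h : Dec K D) (hK : K.verts.Finite) :
    D.ncard + 2 ≤ max K.verts.ncard 3 := by
  induction h with
  | single K =>
    rw [Set.ncard_singleton]
    exact le_max_right _ _
  | @node K K₁ K₂ v D₁ D₂ h h₁ h₂ hi ih₁ ih₂ =>
    have i₁ := ih₁ (h.finite_left hK)
    have i₂ := ih₂ (h.symm.finite_left hK)
    have c₁ := h.ncard hK
    have c₂ := h.symm.ncard hK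
    have := Set.ncard_union_le D₁ D₂
    omega

/-- A split decomposition with the greatest number of graphs contains only prime graphs. -/
lemma exists_isPCSDecomp [Infinite α] {K : LGraph α} (hK : ConnOn K K.verts)
    (hfin : K.verts.Finite) : ∃ D, IsPCSDecomp K D := by
  let S : Set ℕ := {k | ∃ D, IsSplitDecomp K D ∧ D.ncard = k}
  have hne : S.Nonempty := ⟨_, {K}, .refl, rfl⟩
  have hbdd : BddAbove S := by
    refine ⟨max K.verts.ncard 3, ?_⟩
    rintro k ⟨D, hD, rfl⟩
    have := (Dec.of_isSplitDecomp hK hD).ncard_le hfin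
    omega
  obtain ⟨D, hD, hmax⟩ := Nat.sSup_mem hne hbdd
  refine ⟨D, hD, fun L hL => Or.inl ?_⟩
  rintro ⟨V₁, V₂, hs⟩
  have hdec := Dec.of_isSplitDecomp hK hD
  obtain ⟨v, hv⟩ := (hdec.finite_labels hfin).exists_notMem
  have hstep : SplitStep D ((D \ {L}) ∪ {withMarker L V₁ V₂ v, withMarker L V₂ V₁ v}) :=
    ⟨L, hL, v, _, _, fun X hX hvX => hv ⟨X, hX, hvX⟩,
      ⟨fun h => hv ⟨L, hL, h⟩, V₁, V₂, hs, rfl, rfl⟩, rfl⟩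
  have h₁ := (hstep.ncard hdec.finite).2
  have h₂ := le_csSup hbdd ⟨_, hD.tail hstep, rfl⟩
  omega

/-- A decomposition into prime graphs, cliques and stars with the least number of graphs is
standard. -/
lemma exists_isStandardDecomp [Infinite α] {K : LGraph α} (hK : ConnOn K K.verts)
    (hfin : K.verts.Finite) : ∃ D, IsStandardDecomp K D := by
  obtain ⟨D, hD, hmin⟩ := WellFounded.has_min (InvImage.wf Set.ncard Nat.lt_wfRel.wf)
    {D | IsPCSDecomp K D} (exists_isPCSDecomp hK hfin)
  refine ⟨D, hD, fun D' hD' href => hmin D' hD' ?_⟩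
  have hf := (Dec.of_isSplitDecomp hK hD'.1).finite
  suffices D.Finite ∧ D'.ncard < D.ncard from this.2
  unfold IsStrictRefinement at href
  clear hmin hD
  induction href with
  | single h =>
    obtain ⟨h₁, h₂⟩ := h.ncard hf
    exact ⟨h₁, by omega⟩
  | tail _ h ih =>
    obtain ⟨h₁, h₂⟩ := h.ncard ih.1
    exact ⟨h₁, by omega⟩

/-- If a marker were the centre of a star `x` and a leaf of a star `y`, then `x` and `y` could be
merged into a single star. -/
lemma IsStandardDecomp.starReduced {K : LGraph α} {D : Set (LGraph α)} (hK : ConnOn K K.verts)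
    (h : IsStandardDecomp K D) : StarReduced D := by
  intro x hx y hy hne m c hmx hmy hxm hyc
  by_contra hcm
  have hdec := Dec.of_isSplitDecomp hK h.1.1
  obtain ⟨M, hM, hmD, hMD, hd⟩ := hdec.merge_at hx hy hne hmx hmy
  have hcx : c ∉ x.verts := fun hcx => hcm (hM.inter c hcx hyc.1)
  have cross : ∀ s ∈ x.verts, ∀ t ∈ y.verts, s ≠ m → t ≠ m → (M.Adj s t ↔ t = c) := by
    intro s hs t ht hsm htm
    rw [hM.adj_cross hs ht hsm htm, hxm.2 s hs m hmx, hyc.2 m hmy t ht]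
    have : m ≠ c := fun e => hcm e.symm
    have := htm.symm
    tauto
  have hstar : IsStar M := by
    refine ⟨c, hM.mem_right hyc.1 hcm, fun s hs t ht => ?_⟩
    obtain ⟨hsm, hs⟩ := (hM.mem_iff s).1 hs
    obtain ⟨htm, ht⟩ := (hM.mem_iff t).1 ht
    have out : ∀ z, z ∈ x.verts → z ≠ c := fun z hz e => hcx (e ▸ hz)
    rcases hs with hs | hs <;> rcases ht with ht | ht
    · rw [hM.adj_left hs ht hsm htm, hxm.2 s hs t ht]
      have := out s hs
      have := out t ht
      tauto
    · rw [cross s hs t ht hsm htm]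
      have h₁ := out s hs
      have : t = c → s ≠ t := fun e e' => h₁ (e'.trans e)
      tauto
    · rw [M.adj_comm, cross t ht s hs htm hsm]
      have h₁ := out t ht
      have : s = c → s ≠ t := fun e e' => h₁ (e'.symm.trans e)
      tauto
    · rw [hM.symm.adj_left hs ht hsm htm, hyc.2 s hs t ht]
  refine h.2 _ ⟨hd.isSplitDecomp, ?_⟩ (.single ⟨M, Or.inl rfl, m, x, y, ?_,
    hM.isSimpleSplitDecomp, ?_⟩)
  · rintro L (rfl | hL)
    · exact Or.inr (Or.inr hstar)
    · exact h.1.2 L hL.1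
  · exact fun L hL hmL => hmD ⟨L, hL, hmL⟩
  · rw [Set.insert_sdiff_self_of_notMem fun h => hMD h.1, Set.sdiff_union_of_subset]
    rintro L (rfl | rfl)
    exacts [hx, hy]

/-! ### Pruning -/

lemma pruneStep_iff {D D' : Set (LGraph α)} : PruneStep D D' ↔
    ∃ x y, IsLeafOf D x y ∧ (∃ l ∈ y.verts, IsUniversalIn x l) ∧ D' = D \ {x} := by
  constructor
  · rintro ⟨⟨x, hx⟩, ⟨y, hy⟩, hxy, hl, rfl⟩
    have h := (hxy ⟨y, hy⟩).2 rfl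
    refine ⟨x, y, ⟨hx, hy, fun e => h.1 (Subtype.ext e), h.2, fun z hz hne hm => ?_⟩, hl, rfl⟩
    exact congrArg Subtype.val
      ((hxy ⟨z, hz⟩).1 ⟨fun e => hne (congrArg Subtype.val e).symm, hm⟩)
  · rintro ⟨x, y, h, hl, rfl⟩
    refine ⟨⟨x, h.mem⟩, ⟨y, h.mem'⟩, fun z => ⟨fun hz => ?_, ?_⟩, hl, rfl⟩
    · exact Subtype.ext (h.unique z z.2 (fun e => hz.1 (Subtype.ext e.symm)) hz.2)
    · rintro rfl
      exact ⟨fun e => h.ne (congrArg Subtype.val e), h.meet⟩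

/-- What remains after pruning is a decomposition of an induced subgraph of `K₀`, from which `K₀`
is recovered by substituting cliques and independent sets for vertices. -/
lemma Dec.prune [Countable α] {K₀ : LGraph α} {D₀ D : Set (LGraph α)} (h₀ : Dec K₀ D₀)
    (hK₀ : ConnOn K₀ K₀.verts) (hne : K₀.verts.Nonempty)
    (hcs : ∀ L ∈ D₀, IsCliqueGraph L ∨ IsStar L) (h : Relation.ReflTransGen PruneStep D₀ D) :
    ∃ K, Dec K D ∧ ConnOn K K.verts ∧ K.verts.Nonempty ∧ D ⊆ D₀ ∧ (HasAT K → HasAT K₀) ∧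
      (IsPerm K → IsPerm K₀) := by
  induction h with
  | refl => exact ⟨K₀, h₀, hK₀, hne, subset_rfl, id, id⟩
  | tail _ hstep ih =>
    obtain ⟨K, hd, hK, -, hsub, hAT, hP⟩ := ih
    obtain ⟨x, y, hx, ⟨m, hmy, hm⟩, rfl⟩ := pruneStep_iff.1 hstep
    obtain ⟨K', hc, hd'⟩ := hd.remove_leafOf hx hm.1 hmy
    exact ⟨K', hd', hc.symm.connOn_left hK, ⟨m, hc.right_mem⟩, Set.sdiff_subset.trans hsub,
      fun h => hAT (hc.symm.embeds_left.hasAT h),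
      fun h => hP (hc.isPerm_of_universal (hcs x (hsub hx.mem)) hm h)⟩

lemma exists_pruned {D : Set (LGraph α)} (hD : D.Finite) :
    ∃ E, Relation.ReflTransGen PruneStep D E ∧ ¬ ∃ F, PruneStep E F := by
  obtain ⟨k, hk⟩ : ∃ k, D.ncard = k := ⟨_, rfl⟩
  induction k using Nat.strong_induction_on generalizing D with
  | _ k ih =>
  by_cases h : ∃ F, PruneStep D F
  · obtain ⟨F, hF⟩ := h
    obtain ⟨x, y, hx, -, rfl⟩ := pruneStep_iff.1 hF
    obtain ⟨E, hE, hmax⟩ := ih _ (hk ▸ Set.ncard_sdiff_singleton_lt_of_mem hx.mem hD)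
      (hD.subset Set.sdiff_subset) rfl
    exact ⟨E, hE.head hF, hmax⟩
  · exact ⟨D, .refl, h⟩

/-! ### The characterization -/

section Graph

variable {V : Type*} [Finite V] {G : SimpleGraph V} {D : Set (LGraph (V ⊕ ℕ))}

/-- The data extracted from a pruned decomposition of a connected distance hereditary graph. -/
lemma IsPrunedDecomp.exists_dec (hconn : G.Connected) (hdh : IsDistanceHereditary G)
    (h : IsPrunedDecomp (toLGraph G) D) :
    ∃ K, Dec K D ∧ ConnOn K K.verts ∧ K.verts.Nonempty ∧
      (∀ L ∈ D, IsCliqueGraph L ∨ IsStar L) ∧ StarReduced D ∧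
      (∀ x y, IsLeafOf D x y → ∀ l ∈ y.verts, ¬ IsUniversalIn x l) ∧
      (HasAT K → HasAT (toLGraph G)) ∧ (IsPerm K → IsPerm (toLGraph G)) := by
  obtain ⟨D₀, hD₀, hprune, hmax⟩ := h
  have hK₀ := connOn_toLGraph hconn
  have hdec := Dec.of_isSplitDecomp hK₀ hD₀.1.1
  have hcs : ∀ L ∈ D₀, IsCliqueGraph L ∨ IsStar L := by
    intro L hL
    rcases hD₀.1.2 L hL with hp | hcs
    · exact isCliqueGraph_or_isStar_of_isPrime (hdec.connOn_of_mem hK₀ L hL)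
        (hdec.levelTwins_of_mem hdh.levelTwins L hL) hp
    · exact hcs
  obtain ⟨v⟩ := hconn.nonempty
  obtain ⟨K, hd, hK, hne, hsub, hAT, hP⟩ := hdec.prune hK₀ ⟨_, mem_toLGraph v⟩ hcs hprune
  have hred := hD₀.starReduced hK₀
  exact ⟨K, hd, hK, hne, fun L hL => hcs L (hsub hL),
    fun x hx y hy => hred x (hsub hx) y (hsub hy),
    fun x y hxy l hl hu => hmax ⟨_, pruneStep_iff.2 ⟨x, y, hxy, ⟨l, hl, hu⟩, rfl⟩⟩, hAT, hP⟩

lemma exists_isPrunedDecomp (hconn : G.Connected) : ∃ D, IsPrunedDecomp (toLGraph G) D := by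
  have hK₀ := connOn_toLGraph hconn
  obtain ⟨D₀, hD₀⟩ := exists_isStandardDecomp hK₀ (Set.finite_range Sum.inl)
  obtain ⟨D, hD, hmax⟩ := exists_pruned (Dec.of_isSplitDecomp hK₀ hD₀.1.1).finite
  exact ⟨D, D₀, hD₀, hD, hmax⟩

end Graph

end SplitDecomp

theorem theorem3p6 {V : Type*} [Finite V] (G : SimpleGraph V) (hconn : G.Connected)
    (hdh : SplitDecomp.IsDistanceHereditary G) :
    List.TFAE [
      SplitDecomp.IsPermutationGraph G,
      SplitDecomp.IsATFree G,
      ∃ D : Set (SplitDecomp.LGraph (V ⊕ ℕ)),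
        SplitDecomp.IsPrunedDecomp (SplitDecomp.toLGraph G) D ∧
          SplitDecomp.IsPathGraph (SplitDecomp.decompTree D),
      ∀ D : Set (SplitDecomp.LGraph (V ⊕ ℕ)),
        SplitDecomp.IsPrunedDecomp (SplitDecomp.toLGraph G) D →
          SplitDecomp.IsPathGraph (SplitDecomp.decompTree D)] := by
  tfae_have 1 → 2 := fun h => h.isATFree
  tfae_have 2 → 4 := by
    intro hfree D hD
    obtain ⟨K, hd, hK, -, hcs, hred, hnp, hAT, -⟩ := hD.exists_dec hconn hdh
    refine SplitDecomp.isPathGraph_iff.2 (hd.pathEnum fun a b c a' b' c' ha hb hc => ?_)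
    by_contra hne
    push Not at hne
    exact SplitDecomp.not_isATFree_of_hasAT (hAT (hd.hasAT_of_three_leaves hK hcs hred hnp ha hb hc
      hne.1 hne.2.1 hne.2.2)) hfree
  tfae_have 4 → 3 := by
    intro h
    obtain ⟨D, hD⟩ := SplitDecomp.exists_isPrunedDecomp hconn
    exact ⟨D, hD, h D hD⟩
  tfae_have 3 → 1 := by
    rintro ⟨D, hD, hpath⟩
    obtain ⟨K, hd, -, hne, hcs, -, -, -, hP⟩ := hD.exists_dec hconn hdh
    obtain ⟨n, f, hf⟩ := SplitDecomp.isPathGraph_iff.1 hpath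
    exact SplitDecomp.isPermutationGraph_of_isPerm (hP (hd.isPerm_of_path hne hcs hf))
  tfae_finish
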